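/- Let $\varpi = 2\int_0^1 \frac{dt}{\sqrt{1-t^4}}$. Let $\varphi:\mathbb{R}\to\mathbb{R}$ be the function that on $[-\varpi/2,\varpi/2]$ is the inverse of $r\mapsto \int_0^r \frac{dt}{\sqrt{1-t^4}}$, $-1\le r\le 1$, and that satisfies $\varphi(s+\varpi)=-\varphi(s)$ for all $s$ (so it has period $2\varpi$). Extend $\varphi$ to complex arguments $z=x+iy$ by $$\varphi(x+iy)=\frac{\varphi(x)\varphi'(y)+i\,\varphi(y)\varphi'(x)}{1-\varphi(x)^2\varphi(y)^2};$$ this is an elliptic function for the lattice $L=\mathbb{Z}(1+i)\varpi+\mathbb{Z}(1-i)\varpi$. Let $\beta\in\mathbb{Z}[i]$ be odd, i.e. relatively prime to $1+i$, put $\delta_\beta=\frac{(1+i)\varpi}{\beta}$, and define the $\beta$-th lemnatomic polynomial by $$\Lambda_\beta(x)=\prod_{[\alpha]\in(\mathbb{Z}[i]/\beta\mathbb{Z}[i])^\times}\bigl(x-\varphi(\alpha\delta_\beta)\bigr),$$ where each factor depends only on the class $[\alpha]$. Then $\Lambda_\beta\in\mathbb{Z}[i][x]$, and $\Lambda_\beta$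 is monic of degree $\bigl|(\mathbb{Z}[i]/\beta\mathbb{Z}[i])^\times\bigr|$. -/

import Mathlib

namespace Lemniscate

open Polynomial

noncomputable section

/-- The signed arc length `∫₀ʳ dt / √(1 - t⁴)` of the lemniscate, for `r ∈ [-1, 1]`. -/
def arcLength (r : ℝ) : ℝ := ∫ t in (0 : ℝ)..r, 1 / √(1 - t ^ 4)

/-- The lemniscate constant `ϖ`; the first-quadrant arc `arcLength 1` has length `ϖ / 2`. -/
def varpi : ℝ := 2 * arcLength 1

/-- Abel's function `φ` on `ℝ`. On `[-ϖ/2, ϖ/2]` it is the inverse of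
`arcLength : [-1, 1] → [-ϖ/2, ϖ/2]`; it is extended to `ℝ` by `φ (s + ϖ) = -φ s`
(the radial coordinate along the lemniscate, which has period `2ϖ`). -/
def phiReal (s : ℝ) : ℝ :=
  (-1 : ℝ) ^ round (s / varpi) *
    Function.invFunOn arcLength (Set.Icc (-1) 1) (s - round (s / varpi) * varpi)

/-- The extension of `φ` to `ℂ`, forced by the addition law and `φ (i y) = i φ y`:
`φ (x + i y) = (φ x φ' y + i φ y φ' x) / (1 - φ(x)² φ(y)²)`.
The denominator vanishes only at the poles `≡ (1 ± i)ϖ/2` modulo the period lattice, where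
this function takes the irrelevant value `0`. -/
def phi (z : ℂ) : ℂ :=
  ((phiReal z.re : ℂ) * ((deriv phiReal z.im : ℝ) : ℂ)
      + Complex.I * (phiReal z.im : ℂ) * ((deriv phiReal z.re : ℝ) : ℂ))
    / (1 - (phiReal z.re : ℂ) ^ 2 * (phiReal z.im : ℂ) ^ 2)

lemma intervalIntegrable_arcLength :
    IntervalIntegrable (fun t : ℝ => 1 / √(1 - t ^ 4)) MeasureTheory.volume 0 1 := by
  have h1 : IntervalIntegrable (fun t : ℝ => (1 - t) ^ (-(1 / 2) : ℝ))
      MeasureTheory.volume 0 1 := by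
    have h := (intervalIntegral.intervalIntegrable_rpow' (a := 0) (b := 1)
      (r := (-(1 / 2) : ℝ)) (by norm_num)).comp_sub_left 1
    simpa using h.symm
  refine h1.mono_fun' ?_ ?_
  · exact (by fun_prop : Measurable (fun t : ℝ => 1 / √(1 - t ^ 4))).aestronglyMeasurable
  · refine (MeasureTheory.ae_restrict_iff' measurableSet_uIoc).2 (.of_forall fun t ht => ?_)
    rw [Set.uIoc_of_le zero_le_one] at ht
    obtain ⟨h0, h1⟩ := ht
    dsimp only
    rw [Real.norm_of_nonneg (by positivity)]
    rcases h1.eq_or_lt with rfl | h1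
    · norm_num
    · rw [Real.rpow_neg (by linarith), ← Real.sqrt_eq_rpow, ← one_div]
      have h2 : 1 - t ≤ 1 - t ^ 4 := by
        have := pow_le_of_le_one h0.le h1.le (n := 4) (by norm_num)
        linarith
      exact one_div_le_one_div_of_le (Real.sqrt_pos.2 (by linarith)) (Real.sqrt_le_sqrt h2)

lemma varpi_pos : 0 < varpi := by
  have h : 0 < arcLength 1 := by
    refine intervalIntegral.intervalIntegral_pos_of_pos_on intervalIntegrable_arcLength ?_
      zero_lt_one
    intro t ht
    have := pow_lt_one₀ ht.1.le ht.2 (n := 4) (by norm_num)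
    have : 0 < √(1 - t ^ 4) := Real.sqrt_pos.2 (by linarith)
    positivity
  unfold varpi
  linarith

lemma phiReal_add_varpi (s : ℝ) : phiReal (s + varpi) = -phiReal s := by
  have h : (s + varpi) / varpi = s / varpi + 1 := by
    rw [add_div, div_self varpi_pos.ne']
  unfold phiReal
  rw [h, round_add_one, zpow_add_one₀ (by norm_num)]
  have h2 : s + varpi - ((round (s / varpi) + 1 : ℤ) : ℝ) * varpi
      = s - round (s / varpi) * varpi := by
    push_cast; ring
  rw [h2]; ring

lemma deriv_phiReal_add_varpi (s : ℝ) :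
    deriv phiReal (s + varpi) = -deriv phiReal s := by
  rw [← deriv_comp_add_const, funext phiReal_add_varpi, deriv.fun_neg]

lemma phiReal_sub_varpi (s : ℝ) : phiReal (s - varpi) = -phiReal s := by
  have h := phiReal_add_varpi (s - varpi)
  rw [sub_add_cancel] at h
  rw [h, neg_neg]

lemma deriv_phiReal_sub_varpi (s : ℝ) :
    deriv phiReal (s - varpi) = -deriv phiReal s := by
  have h := deriv_phiReal_add_varpi (s - varpi)
  rw [sub_add_cancel] at h
  rw [h, neg_neg]

lemma phi_periodic_one_add_I : Function.Periodic phi ((1 + Complex.I) * varpi) := by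
  intro z
  have h1 : (z + (1 + Complex.I) * varpi).re = z.re + varpi := by simp
  have h2 : (z + (1 + Complex.I) * varpi).im = z.im + varpi := by simp
  unfold phi
  rw [h1, h2]
  simp only [phiReal_add_varpi, deriv_phiReal_add_varpi]
  push_cast
  ring

lemma phi_periodic_one_sub_I : Function.Periodic phi ((1 - Complex.I) * varpi) := by
  intro z
  have h1 : (z + (1 - Complex.I) * varpi).re = z.re + varpi := by simp
  have h2 : (z + (1 - Complex.I) * varpi).im = z.im - varpi := by
    simp [sub_eq_add_neg]
  unfold phi
  rw [h1, h2]
  simp only [phiReal_add_varpi, deriv_phiReal_add_varpi, phiReal_sub_varpi,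
    deriv_phiReal_sub_varpi]
  push_cast
  ring

lemma phi_add_lattice (z : ℂ) (γ : GaussianInt) :
    phi (z + GaussianInt.toComplex γ * ((1 + Complex.I) * varpi)) = phi z := by
  have h : GaussianInt.toComplex γ * ((1 + Complex.I) * varpi)
      = γ.re • ((1 + Complex.I) * (varpi : ℂ))
        + (-γ.im) • ((1 - Complex.I) * (varpi : ℂ)) := by
    rw [GaussianInt.toComplex_def]
    simp only [zsmul_eq_mul]
    push_cast
    linear_combination (γ.im : ℂ) * varpi * Complex.I_mul_I
  rw [h, ← add_assoc, phi_periodic_one_sub_I.zsmul, phi_periodic_one_add_I.zsmul]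

/-- A Gaussian integer is odd if it is relatively prime to `1 + i`. -/
def IsOdd (β : GaussianInt) : Prop := IsCoprime β ⟨1, 1⟩

/-- The `β`-torsion generator `δ_β = (1 + i)ϖ / β`. -/
def delta (β : GaussianInt) : ℂ := (1 + Complex.I) * varpi / GaussianInt.toComplex β

lemma phi_mul_delta_congr (β a b : GaussianInt) (h : b - a ∈ Ideal.span {β}) :
    phi (GaussianInt.toComplex a * delta β) = phi (GaussianInt.toComplex b * delta β) := by
  obtain ⟨γ, hγ⟩ := Ideal.mem_span_singleton'.1 h
  obtain rfl : b = a + γ * β := by rw [hγ]; ring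
  rcases eq_or_ne β 0 with rfl | hβ
  · simp
  · have hβ' : GaussianInt.toComplex β ≠ 0 := by
      simpa [GaussianInt.toComplex_eq_zero] using hβ
    have h2 : GaussianInt.toComplex (a + γ * β) * delta β
        = GaussianInt.toComplex a * delta β
          + GaussianInt.toComplex γ * ((1 + Complex.I) * varpi) := by
      unfold delta
      rw [map_add, map_mul]
      field_simp
    rw [h2, phi_add_lattice]

/-- The division value `φ (α δ_β)` as a function of the class `[α] ∈ ℤ[i] / βℤ[i]`. -/
def divisionValue (β : GaussianInt) (u : GaussianInt ⧸ Ideal.span {β}) : ℂ :=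
  Quotient.liftOn' u (fun α => phi (GaussianInt.toComplex α * delta β)) fun a b hab =>
    (phi_mul_delta_congr β b a ((Submodule.quotientRel_def _).1 hab)).symm

/-- The `β`-th lemnatomic polynomial
`Λ_β(x) = ∏ (x - φ (α δ_β))` over `[α] ∈ (ℤ[i] / βℤ[i])ˣ`. -/
def lemnatomic (β : GaussianInt) : ℂ[X] :=
  ∏ᶠ u : (GaussianInt ⧸ Ideal.span {β})ˣ,
    (X - C (divisionValue β (u : GaussianInt ⧸ Ideal.span {β})))

end

end Lemniscate

/-! Since `φ'² = 1 - φ⁴`, the pair `(φ, φ')` parametrises the quartic `c² = 1 - s⁴`, a model of the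
elliptic curve `E : v² = u³ + 4u` with `s = 2u/v`. The addition law of `φ` becomes the group law of
`E` (`quarticPoint_add`). This gives a homomorphism `param : ℂ → E(ℂ)`, equivariant for ℤ[i] acting
on `E` by `[i](u, v) = (-u, iv)`, with `φ = sval ∘ param` (`phi_eq_sval`). It is surjective
(`param_surjective`) with kernel `(1+i)ϖ ℤ[i]` (`param_eq_zero_iff`). Hence the points `param (α
δ_β)` are exactly the `β`-torsion, a cyclic ℤ[i]-module isomorphic to ℤ[i]/β.

Galois invariance: a field automorphism of ℂ fixing `i` acts ℤ[i]-linearly on the `β`-torsion, so it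
multiplies by a unit modulo `β` (`exists_unit_mapPoint`). It therefore permutes the roots of `Λ_β`
and fixes its coefficients. An algebraic number fixed by all such automorphisms lies in ℚ(i)
(`mem_range_of_fixed`).

Integrality: if a root `s(P)` were not an algebraic integer, it would lie outside some valuation
ring `V` of ℂ. Translating by a pole of `s` turns `s` into `i/s`, which brings `P + T` into the
kernel of reduction for some 2-torsion point `T`. As `P` has odd order, `T` itself would lie in that
kernel, which is impossible for the `T` that occur (`isIntegral_sval`). So the coefficients are
algebraic integers in ℚ(i), hence in ℤ[i], which is integrally closed.

Monicity and degree are read off the product. -/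

namespace Lemniscate

noncomputable section

open Polynomial WeierstrassCurve

/-! ### The elliptic curve and its multiplication by `i`. -/

/-- The curve `v² = u³ + 4u`. -/
def curve : WeierstrassCurve.Affine ℤ := ⟨0, 0, 0, 4, 0⟩

/-- The group of complex points of `v² = u³ + 4u`. -/
abbrev CPoint : Type := (Affine.baseChange curve ℂ).Point

lemma curve_equation_iff (u v : ℂ) :
    (Affine.baseChange curve ℂ).Equation u v ↔ v ^ 2 = u ^ 3 + 4 * u := by
  rw [Affine.equation_iff]
  simp [curve, Affine.baseChange, baseChange]

lemma curve_nonsingular_iff (u v : ℂ) :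
    (Affine.baseChange curve ℂ).Nonsingular u v ↔ v ^ 2 = u ^ 3 + 4 * u := by
  rw [Affine.nonsingular_iff, curve_equation_iff]
  refine and_iff_left_of_imp fun h => ?_
  simp [curve, Affine.baseChange, baseChange]
  by_contra! hc
  obtain ⟨h1, h2⟩ := hc
  have hv : v = 0 := by linear_combination h2 / 2
  have h3 : 3 * u ^ 2 + 4 = 0 := by linear_combination -h1
  subst hv
  have h4 : u * 8 = 0 := by linear_combination -3 * h - u * h3
  have : u = 0 := by simpa using h4
  subst this
  norm_num at h3

/-- The affine point `(u, v)`, or `0` when `(u, v)` does not lie on the curve. -/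
def mkPoint (u v : ℂ) : CPoint :=
  open Classical in
  if h : v ^ 2 = u ^ 3 + 4 * u then .some u v ((curve_nonsingular_iff u v).2 h) else 0

lemma mkPoint_of_eq {u v : ℂ} (h : v ^ 2 = u ^ 3 + 4 * u) :
    mkPoint u v = .some u v ((curve_nonsingular_iff u v).2 h) := dif_pos h

lemma point_cases (P : CPoint) :
    P = 0 ∨ ∃ u v : ℂ, v ^ 2 = u ^ 3 + 4 * u ∧ P = mkPoint u v := by
  rcases P with _ | ⟨u, v, h⟩
  · exact .inl rfl
  · have h' := (curve_nonsingular_iff u v).1 h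
    exact .inr ⟨u, v, h', (mkPoint_of_eq h').symm⟩

lemma mkPoint_ne_zero {u v : ℂ} (h : v ^ 2 = u ^ 3 + 4 * u) : mkPoint u v ≠ 0 := by
  rw [mkPoint_of_eq h]
  exact Affine.Point.some_ne_zero _

lemma mkPoint_inj {u v u' v' : ℂ} (h : v ^ 2 = u ^ 3 + 4 * u) (h' : v' ^ 2 = u' ^ 3 + 4 * u') :
    mkPoint u v = mkPoint u' v' ↔ u = u' ∧ v = v' := by
  rw [mkPoint_of_eq h, mkPoint_of_eq h']
  simp

lemma neg_mkPoint {u v : ℂ} (h : v ^ 2 = u ^ 3 + 4 * u) : -mkPoint u v = mkPoint u (-v) := by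
  rw [mkPoint_of_eq h, mkPoint_of_eq (by rw [neg_sq, h]), Affine.Point.neg_some]
  congr 1
  simp [Affine.negY, curve, Affine.baseChange, baseChange]

lemma mkPoint_add_of_ne {u₁ v₁ u₂ v₂ ℓ u₃ v₃ : ℂ} (h₁ : v₁ ^ 2 = u₁ ^ 3 + 4 * u₁)
    (h₂ : v₂ ^ 2 = u₂ ^ 3 + 4 * u₂) (hu : u₁ ≠ u₂) (hl : ℓ * (u₁ - u₂) = v₁ - v₂)
    (hu₃ : u₃ = ℓ ^ 2 - u₁ - u₂) (hv₃ : v₃ = -(ℓ * (u₃ - u₁) + v₁)) :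
    mkPoint u₁ v₁ + mkPoint u₂ v₂ = mkPoint u₃ v₃ := by
  have hu' : u₁ - u₂ ≠ 0 := sub_ne_zero.2 hu
  have hl' : (Affine.baseChange curve ℂ).slope u₁ u₂ v₁ v₂ = ℓ := by
    rw [Affine.slope_of_X_ne hu, ← hl]
    field_simp
  rw [mkPoint_of_eq h₁, mkPoint_of_eq h₂, Affine.Point.add_of_X_ne hu]
  have hX : (Affine.baseChange curve ℂ).addX u₁ u₂
      ((Affine.baseChange curve ℂ).slope u₁ u₂ v₁ v₂) = u₃ := by
    rw [hl', hu₃]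
    simp [Affine.addX, curve, Affine.baseChange, baseChange]
  have hY : (Affine.baseChange curve ℂ).addY u₁ u₂ v₁
      ((Affine.baseChange curve ℂ).slope u₁ u₂ v₁ v₂) = v₃ := by
    rw [Affine.addY, Affine.negAddY, hX, hl', hv₃]
    simp [Affine.negY, curve, Affine.baseChange, baseChange]
  have hn := Affine.nonsingular_add ((curve_nonsingular_iff u₁ v₁).2 h₁)
    ((curve_nonsingular_iff u₂ v₂).2 h₂) (fun h => hu h.1)
  have h₃ : v₃ ^ 2 = u₃ ^ 3 + 4 * u₃ := by
    rw [hX, hY] at hn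
    exact (curve_nonsingular_iff _ _).1 hn
  rw [mkPoint_of_eq h₃]
  simp only [hX, hY]

lemma mkPoint_double {u v ℓ u₃ v₃ : ℂ} (h : v ^ 2 = u ^ 3 + 4 * u) (hv : v ≠ 0)
    (hl : ℓ * (2 * v) = 3 * u ^ 2 + 4)
    (hu₃ : u₃ = ℓ ^ 2 - u - u) (hv₃ : v₃ = -(ℓ * (u₃ - u) + v)) :
    mkPoint u v + mkPoint u v = mkPoint u₃ v₃ := by
  have hne : v ≠ (Affine.baseChange curve ℂ).negY u v := by
    simp [Affine.negY, curve, Affine.baseChange, baseChange]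
    intro h'
    apply hv
    linear_combination h' / 2
  have hl' : (Affine.baseChange curve ℂ).slope u u v v = ℓ := by
    rw [Affine.slope_of_Y_ne rfl hne]
    simp [Affine.negY, curve, Affine.baseChange, baseChange]
    rw [← hl]
    field_simp
    ring
  rw [mkPoint_of_eq h, Affine.Point.add_self_of_Y_ne hne]
  have hX : (Affine.baseChange curve ℂ).addX u u
      ((Affine.baseChange curve ℂ).slope u u v v) = u₃ := by
    rw [hl', hu₃]
    simp [Affine.addX, curve, Affine.baseChange, baseChange]
  have hY : (Affine.baseChange curve ℂ).addY u u v
      ((Affine.baseChange curve ℂ).slope u u v v) = v₃ := by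
    rw [Affine.addY, Affine.negAddY, hX, hl', hv₃]
    simp [Affine.negY, curve, Affine.baseChange, baseChange]
  have hn := Affine.nonsingular_add ((curve_nonsingular_iff u v).2 h)
    ((curve_nonsingular_iff u v).2 h) (fun h => hne h.2)
  have h₃ : v₃ ^ 2 = u₃ ^ 3 + 4 * u₃ := by
    rw [hX, hY] at hn
    exact (curve_nonsingular_iff _ _).1 hn
  rw [mkPoint_of_eq h₃]
  simp only [hX, hY]

/-- The map `(u, v) ↦ (-u, i v)` on points. -/
def mulIFun (P : CPoint) : CPoint :=
  match P with
  | .zero => 0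
  | .some u v _ => mkPoint (-u) (Complex.I * v)

lemma mulIFun_mkPoint {u v : ℂ} (h : v ^ 2 = u ^ 3 + 4 * u) :
    mulIFun (mkPoint u v) = mkPoint (-u) (Complex.I * v) := by
  rw [mkPoint_of_eq h]; rfl

lemma mul_I_equation {u v : ℂ} (h : v ^ 2 = u ^ 3 + 4 * u) :
    (Complex.I * v) ^ 2 = (-u) ^ 3 + 4 * (-u) := by
  linear_combination v ^ 2 * Complex.I_sq - h

lemma mkPoint_add_cases {u₁ v₁ u₂ v₂ : ℂ} (h₁ : v₁ ^ 2 = u₁ ^ 3 + 4 * u₁)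
    (h₂ : v₂ ^ 2 = u₂ ^ 3 + 4 * u₂) :
    u₁ ≠ u₂ ∨ (u₁ = u₂ ∧ v₁ = -v₂) ∨ (u₁ = u₂ ∧ v₁ = v₂ ∧ v₁ ≠ 0) := by
  by_cases hu : u₁ = u₂
  · subst hu
    have : (v₁ - v₂) * (v₁ + v₂) = 0 := by linear_combination h₁ - h₂
    rcases mul_eq_zero.1 this with h | h
    · have h := sub_eq_zero.1 h
      by_cases hv : v₁ = 0
      · exact .inr (.inl ⟨rfl, by rw [← h, hv, neg_zero]⟩)
      · exact .inr (.inr ⟨rfl, h, hv⟩)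
    · exact .inr (.inl ⟨rfl, eq_neg_of_add_eq_zero_left h⟩)
  · exact .inl hu

lemma mulIFun_add (P Q : CPoint) : mulIFun (P + Q) = mulIFun P + mulIFun Q := by
  rcases point_cases P with rfl | ⟨u₁, v₁, h₁, rfl⟩
  · rw [zero_add]; exact (zero_add _).symm
  rcases point_cases Q with rfl | ⟨u₂, v₂, h₂, rfl⟩
  · rw [add_zero]; exact (add_zero _).symm
  rw [mulIFun_mkPoint h₁, mulIFun_mkPoint h₂]
  rcases mkPoint_add_cases h₁ h₂ with hu | ⟨rfl, rfl⟩ | ⟨rfl, rfl, hv⟩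
  · have hu' : u₁ - u₂ ≠ 0 := sub_ne_zero.2 hu
    have hl : (v₁ - v₂) / (u₁ - u₂) * (u₁ - u₂) = v₁ - v₂ := by field_simp
    generalize (v₁ - v₂) / (u₁ - u₂) = ℓ at hl
    have key := mkPoint_add_of_ne h₁ h₂ hu hl rfl rfl
    have key' := mkPoint_add_of_ne (mul_I_equation h₁) (mul_I_equation h₂) (ℓ := -Complex.I * ℓ)
      (by simpa using hu) (by linear_combination Complex.I * hl) rfl rfl
    -- Off the curve `mkPoint` takes the default value `0`, which would make the two points
    -- opposite, against `hu`.
    have h₃ : (-(ℓ * (ℓ ^ 2 - u₁ - u₂ - u₁) + v₁)) ^ 2 = (ℓ ^ 2 - u₁ - u₂) ^ 3 + 4 * (ℓ ^ 2 - u₁ - u₂) := by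
      by_contra hc
      have h0 : mkPoint u₁ v₁ + mkPoint u₂ v₂ = 0 := by rw [key, mkPoint, dif_neg hc]
      rw [add_eq_zero_iff_eq_neg, neg_mkPoint h₂, mkPoint_inj h₁ (by rw [neg_sq, h₂])] at h0
      exact hu h0.1
    rw [key, key', mulIFun_mkPoint h₃]
    congr 1
    · linear_combination (-ℓ ^ 2) * Complex.I_sq
    · linear_combination (-Complex.I * ℓ ^ 3) * Complex.I_sq
  · have h0 : mkPoint u₁ (-v₂) + mkPoint u₁ v₂ = 0 := by
      rw [add_eq_zero_iff_eq_neg, neg_mkPoint h₂]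
    rw [h0, mul_neg, ← neg_mkPoint (mul_I_equation h₂), neg_add_cancel]
    rfl
  · have hl : (3 * u₁ ^ 2 + 4) / (2 * v₁) * (2 * v₁) = 3 * u₁ ^ 2 + 4 := by field_simp
    generalize (3 * u₁ ^ 2 + 4) / (2 * v₁) = ℓ at hl
    have key := mkPoint_double h₁ hv hl rfl rfl
    have key' := mkPoint_double (mul_I_equation h₁) (ℓ := -Complex.I * ℓ)
      (by simpa using hv) (by linear_combination hl - 2 * ℓ * v₁ * Complex.I_sq) rfl rfl
    have h₃ : (-(ℓ * (ℓ ^ 2 - u₁ - u₁ - u₁) + v₁)) ^ 2 = (ℓ ^ 2 - u₁ - u₁) ^ 3 + 4 * (ℓ ^ 2 - u₁ - u₁) := by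
      by_contra hc
      have h0 : mkPoint u₁ v₁ + mkPoint u₁ v₁ = 0 := by rw [key, mkPoint, dif_neg hc]
      rw [add_eq_zero_iff_eq_neg, neg_mkPoint h₂, mkPoint_inj h₁ (by rw [neg_sq, h₂])] at h0
      exact hv (by linear_combination h0.2 / 2)
    rw [key, key', mulIFun_mkPoint h₃]
    congr 1
    · linear_combination (-ℓ ^ 2) * Complex.I_sq
    · linear_combination (-Complex.I * ℓ ^ 3) * Complex.I_sq

/-- Complex multiplication by `i` on `v² = u³ + 4u`: the endomorphism `(u, v) ↦ (-u, i v)`. -/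
def mulI : CPoint →+ CPoint where
  toFun := mulIFun
  map_zero' := rfl
  map_add' := mulIFun_add

lemma mulI_mkPoint {u v : ℂ} (h : v ^ 2 = u ^ 3 + 4 * u) :
    mulI (mkPoint u v) = mkPoint (-u) (Complex.I * v) := mulIFun_mkPoint h

lemma mulI_mulI (P : CPoint) : mulI (mulI P) = -P := by
  rcases point_cases P with rfl | ⟨u, v, h, rfl⟩
  · simp
  · rw [mulI_mkPoint h, mulI_mkPoint (mul_I_equation h), neg_mkPoint h]
    congr 1
    · ring
    · linear_combination v * Complex.I_sq

/-! ### Endomorphisms of ℂ acting on points, and the function `2u/v`. -/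

/-- The action of a ring endomorphism of `ℂ` on points. -/
def mapPoint (σ : ℂ →+* ℂ) : CPoint →+ CPoint :=
  Affine.Point.map (W' := curve) σ.toIntAlgHom

lemma map_equation {u v : ℂ} (σ : ℂ →+* ℂ) (h : v ^ 2 = u ^ 3 + 4 * u) :
    σ v ^ 2 = σ u ^ 3 + 4 * σ u := by
  simpa [map_ofNat σ 4] using congrArg σ h

lemma mapPoint_mkPoint (σ : ℂ →+* ℂ) {u v : ℂ} (h : v ^ 2 = u ^ 3 + 4 * u) :
    mapPoint σ (mkPoint u v) = mkPoint (σ u) (σ v) := by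
  rw [mkPoint_of_eq h, mkPoint_of_eq (map_equation σ h)]
  rfl

/-- The function `2u / v` on the curve, which corresponds to `φ`. -/
def sval (P : CPoint) : ℂ :=
  match P with
  | .zero => 0
  | .some u v _ => 2 * u / v

lemma sval_mkPoint {u v : ℂ} (h : v ^ 2 = u ^ 3 + 4 * u) : sval (mkPoint u v) = 2 * u / v := by
  rw [mkPoint_of_eq h]; rfl

@[simp] lemma sval_zero : sval 0 = 0 := rfl

lemma sval_mapPoint (σ : ℂ →+* ℂ) (P : CPoint) : sval (mapPoint σ P) = σ (sval P) := by
  rcases point_cases P with rfl | ⟨u, v, h, rfl⟩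
  · simp
  · rw [mapPoint_mkPoint σ h, sval_mkPoint h, sval_mkPoint (map_equation σ h)]
    simp [map_ofNat σ 2]

lemma mapPoint_mulI (σ : ℂ →+* ℂ) (hσ : σ Complex.I = Complex.I) (P : CPoint) :
    mapPoint σ (mulI P) = mulI (mapPoint σ P) := by
  rcases point_cases P with rfl | ⟨u, v, h, rfl⟩
  · simp
  · rw [mulI_mkPoint h, mapPoint_mkPoint σ h, mulI_mkPoint (map_equation σ h),
      mapPoint_mkPoint σ (mul_I_equation h)]
    simp [hσ]

lemma mapPoint_conj_mulI (P : CPoint) :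
    mapPoint (starRingEnd ℂ) (mulI P) = -mulI (mapPoint (starRingEnd ℂ) P) := by
  rcases point_cases P with rfl | ⟨u, v, h, rfl⟩
  · simp
  · have h' := map_equation (starRingEnd ℂ) h
    rw [mulI_mkPoint h, mapPoint_mkPoint _ h, mulI_mkPoint h',
      mapPoint_mkPoint _ (mul_I_equation h), neg_mkPoint (mul_I_equation h')]
    simp

lemma mapPoint_conj_conj (P : CPoint) :
    mapPoint (starRingEnd ℂ) (mapPoint (starRingEnd ℂ) P) = P := by
  rcases point_cases P with rfl | ⟨u, v, h, rfl⟩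
  · simp
  · rw [mapPoint_mkPoint _ h, mapPoint_mkPoint _ (map_equation _ h)]
    simp

/-! ### The quartic model `c² = 1 - s⁴` and its addition law. -/

/-- The point of `v² = u³ + 4u` corresponding to the point `(s, c)` of `c² = 1 - s⁴`. -/
def quarticPoint (s c : ℂ) : CPoint :=
  open Classical in if c = 1 then 0 else mkPoint (2 * s ^ 2 / (1 - c)) (4 * s / (1 - c))

lemma quarticPoint_one (s : ℂ) : quarticPoint s 1 = 0 := if_pos rfl

lemma quarticPoint_of_ne (s : ℂ) {c : ℂ} (hc : c ≠ 1) :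
    quarticPoint s c = mkPoint (2 * s ^ 2 / (1 - c)) (4 * s / (1 - c)) := if_neg hc

lemma quarticPoint_equation {s c : ℂ} (h : c ^ 2 = 1 - s ^ 4) (hc : c ≠ 1) :
    (4 * s / (1 - c)) ^ 2 = (2 * s ^ 2 / (1 - c)) ^ 3 + 4 * (2 * s ^ 2 / (1 - c)) := by
  have : 1 - c ≠ 0 := sub_ne_zero.2 (Ne.symm hc)
  field_simp
  linear_combination -8 * s ^ 2 * h

lemma sval_quarticPoint {s c : ℂ} (h : c ^ 2 = 1 - s ^ 4) : sval (quarticPoint s c) = s := by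
  by_cases hc : c = 1
  · subst hc
    have : s ^ 4 = 0 := by linear_combination h
    rw [quarticPoint_one, sval_zero, eq_zero_of_pow_eq_zero this]
  · have : 1 - c ≠ 0 := sub_ne_zero.2 (Ne.symm hc)
    rw [quarticPoint_of_ne s hc, sval_mkPoint (quarticPoint_equation h hc)]
    by_cases hs : s = 0
    · simp [hs]
    · field_simp
      norm_num

/-- The addition formula on the quartic `c² = 1 - s⁴`, first coordinate. -/
def addS (s₁ c₁ s₂ c₂ : ℂ) : ℂ := (s₁ * c₂ + s₂ * c₁) / (1 + s₁ ^ 2 * s₂ ^ 2)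

/-- The addition formula on the quartic `c² = 1 - s⁴`, second coordinate. -/
def addC (s₁ c₁ s₂ c₂ : ℂ) : ℂ :=
  (c₁ * c₂ * (1 - s₁ ^ 2 * s₂ ^ 2) - 2 * s₁ * s₂ * (s₁ ^ 2 + s₂ ^ 2)) / (1 + s₁ ^ 2 * s₂ ^ 2) ^ 2

lemma addC_sq {s₁ c₁ s₂ c₂ : ℂ} (h₁ : c₁ ^ 2 = 1 - s₁ ^ 4) (h₂ : c₂ ^ 2 = 1 - s₂ ^ 4)
    (hd : 1 + s₁ ^ 2 * s₂ ^ 2 ≠ 0) :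
    addC s₁ c₁ s₂ c₂ ^ 2 = 1 - addS s₁ c₁ s₂ c₂ ^ 4 := by
  have key : (c₁ * c₂ * (1 - s₁ ^ 2 * s₂ ^ 2) - 2 * s₁ * s₂ * (s₁ ^ 2 + s₂ ^ 2)) ^ 2
      = (1 + s₁ ^ 2 * s₂ ^ 2) ^ 4 - (s₁ * c₂ + s₂ * c₁) ^ 4 := by grind
  unfold addC addS
  rw [div_pow, div_pow, ← pow_mul, key, sub_div, div_self (pow_ne_zero _ hd)]

/-- By the quartic equation `addC = 1` forces `addS = 0`. Squaring `s₁c₂ = -s₂c₁` then gives `(s₁² -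
s₂²)(1 + s₁²s₂²) = 0`. If `s₁ = s₂ ≠ 0`, then `c₁ = -c₂` and `addC = -1`, a contradiction. -/
lemma quarticPoint_add_aux {s₁ c₁ s₂ c₂ : ℂ} (h₁ : c₁ ^ 2 = 1 - s₁ ^ 4) (h₂ : c₂ ^ 2 = 1 - s₂ ^ 4)
    (hd : 1 + s₁ ^ 2 * s₂ ^ 2 ≠ 0) (hc : addC s₁ c₁ s₂ c₂ = 1) : s₁ = -s₂ ∧ c₁ = c₂ := by
  have hS := addC_sq h₁ h₂ hd
  rw [hc] at hS
  have hS : addS s₁ c₁ s₂ c₂ = 0 := eq_zero_of_pow_eq_zero (n := 4) (by linear_combination hS)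
  rw [addS, div_eq_zero_iff, or_iff_left hd] at hS
  rw [addC, div_eq_one_iff_eq (pow_ne_zero _ hd)] at hc
  have hsq : (s₁ ^ 2 - s₂ ^ 2) * (1 + s₁ ^ 2 * s₂ ^ 2) = 0 := by grind
  have hsq := (mul_eq_zero.1 hsq).resolve_right hd
  have : (s₁ - s₂) * (s₁ + s₂) = 0 := by linear_combination hsq
  rcases mul_eq_zero.1 this with h | h
  · obtain rfl := sub_eq_zero.1 h
    by_cases hs : s₁ = 0
    · subst hs
      simp at h₁ h₂ hc ⊢
      rcases h₁ with rfl | rfl <;> grind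
    · have hcc : c₁ = -c₂ := by
        apply mul_left_cancel₀ hs
        linear_combination hS
      subst hcc
      exfalso
      have : (1 + s₁ ^ 2 * s₁ ^ 2) ^ 2 = 0 := by
        have : c₂ ^ 2 = 1 - s₁ ^ 4 := h₂
        grind
      exact hd (eq_zero_of_pow_eq_zero this)
  · obtain rfl : s₁ = -s₂ := by linear_combination h
    refine ⟨rfl, ?_⟩
    by_cases hs : s₂ = 0
    · subst hs
      simp at h₁ h₂ hc ⊢
      rcases h₁ with rfl | rfl <;> grind
    · apply mul_left_cancel₀ hs
      linear_combination hS

lemma quarticPoint_neg {s c : ℂ} (h : c ^ 2 = 1 - s ^ 4) :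
    quarticPoint (-s) c = -quarticPoint s c := by
  by_cases hc : c = 1
  · subst hc
    simp [quarticPoint_one]
  · rw [quarticPoint_of_ne _ hc, quarticPoint_of_ne _ hc, neg_mkPoint (quarticPoint_equation h hc)]
    congr 1 <;> ring

lemma quarticPoint_injective {s₁ c₁ s₂ c₂ : ℂ} (h₁ : c₁ ^ 2 = 1 - s₁ ^ 4) (h₂ : c₂ ^ 2 = 1 - s₂ ^ 4)
    (h : quarticPoint s₁ c₁ = quarticPoint s₂ c₂) : s₁ = s₂ ∧ c₁ = c₂ := by
  have hs : s₁ = s₂ := by rw [← sval_quarticPoint h₁, h, sval_quarticPoint h₂]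
  subst hs
  refine ⟨rfl, ?_⟩
  by_cases hc₁ : c₁ = 1
  · by_cases hc₂ : c₂ = 1
    · rw [hc₁, hc₂]
    · rw [hc₁, quarticPoint_one, quarticPoint_of_ne _ hc₂] at h
      exact absurd h.symm (mkPoint_ne_zero (quarticPoint_equation h₂ hc₂))
  · by_cases hc₂ : c₂ = 1
    · rw [hc₂, quarticPoint_one, quarticPoint_of_ne _ hc₁] at h
      exact absurd h (mkPoint_ne_zero (quarticPoint_equation h₁ hc₁))
    · rw [quarticPoint_of_ne _ hc₁, quarticPoint_of_ne _ hc₂,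
        mkPoint_inj (quarticPoint_equation h₁ hc₁) (quarticPoint_equation h₂ hc₂)] at h
      by_cases hs : s₁ = 0
      · subst hs
        have hn : ∀ c : ℂ, c ≠ 1 → c ^ 2 = 1 - 0 ^ 4 → c = -1 := fun c hc h => by
          have : (c - 1) * (c + 1) = 0 := by linear_combination h
          have := (mul_eq_zero.1 this).resolve_left (sub_ne_zero.2 hc)
          linear_combination this
        rw [hn c₁ hc₁ h₁, hn c₂ hc₂ h₂]
      · have h1 : 1 - c₁ ≠ 0 := sub_ne_zero.2 (Ne.symm hc₁)
        have h2 : 1 - c₂ ≠ 0 := sub_ne_zero.2 (Ne.symm hc₂)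
        have := h.2
        field_simp at this
        linear_combination this

/-- The group law of `v² = u³ + 4u` in terms of the addition formulas on `c² = 1 - s⁴`. -/
lemma quarticPoint_add {s₁ c₁ s₂ c₂ : ℂ} (h₁ : c₁ ^ 2 = 1 - s₁ ^ 4) (h₂ : c₂ ^ 2 = 1 - s₂ ^ 4)
    (hd : 1 + s₁ ^ 2 * s₂ ^ 2 ≠ 0) :
    quarticPoint s₁ c₁ + quarticPoint s₂ c₂
      = quarticPoint (addS s₁ c₁ s₂ c₂) (addC s₁ c₁ s₂ c₂) := by
  by_cases hc₁ : c₁ = 1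
  · subst hc₁
    have : s₁ = 0 := eq_zero_of_pow_eq_zero (n := 4) (by linear_combination h₁)
    subst this
    simp [quarticPoint_one, addS, addC]
  by_cases hc₂ : c₂ = 1
  · subst hc₂
    have : s₂ = 0 := eq_zero_of_pow_eq_zero (n := 4) (by linear_combination h₂)
    subst this
    simp [quarticPoint_one, addS, addC]
  by_cases hneg : s₁ = -s₂ ∧ c₁ = c₂
  · obtain ⟨rfl, rfl⟩ := hneg
    have h : addC (-s₂) c₁ s₂ c₁ = 1 := by
      rw [addC, div_eq_one_iff_eq (pow_ne_zero _ hd)]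
      grind
    rw [h, quarticPoint_one, quarticPoint_neg h₂, neg_add_cancel]
  have hc₃ : addC s₁ c₁ s₂ c₂ ≠ 1 := fun h => hneg (quarticPoint_add_aux h₁ h₂ hd h)
  have E₁ := quarticPoint_equation h₁ hc₁
  have E₂ := quarticPoint_equation h₂ hc₂
  have e₁ : 1 - c₁ ≠ 0 := sub_ne_zero.2 (Ne.symm hc₁)
  have e₂ : 1 - c₂ ≠ 0 := sub_ne_zero.2 (Ne.symm hc₂)
  have e₃ : 1 - addC s₁ c₁ s₂ c₂ ≠ 0 := sub_ne_zero.2 (Ne.symm hc₃)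
  rw [quarticPoint_of_ne _ hc₁, quarticPoint_of_ne _ hc₂, quarticPoint_of_ne _ hc₃]
  unfold addS
  unfold addC at e₃ ⊢
  obtain ⟨D, hD⟩ : ∃ D, D = 1 + s₁ ^ 2 * s₂ ^ 2 := ⟨_, rfl⟩
  obtain ⟨S, hS⟩ : ∃ S, S = s₁ * c₂ + s₂ * c₁ := ⟨_, rfl⟩
  obtain ⟨N, hN⟩ : ∃ N, N = c₁ * c₂ * (1 - s₁ ^ 2 * s₂ ^ 2) - 2 * s₁ * s₂ * (s₁ ^ 2 + s₂ ^ 2) :=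
    ⟨_, rfl⟩
  rw [← hD] at hd
  rw [← hN, ← hD] at e₃
  rw [← hD, ← hS, ← hN]
  have hM : D ^ 2 - N ≠ 0 := fun h => e₃ (by field_simp; linear_combination h)
  have hu₃ : 2 * (S / D) ^ 2 / (1 - N / D ^ 2) = 2 * S ^ 2 / (D ^ 2 - N) := by field_simp
  have hv₃ : 4 * (S / D) / (1 - N / D ^ 2) = 4 * S * D / (D ^ 2 - N) := by field_simp
  rw [hu₃, hv₃]
  rcases mkPoint_add_cases E₁ E₂ with hu | ⟨hu, hv⟩ | ⟨hu, hv, hv0⟩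
  · have hA : s₁ ^ 2 * (1 - c₂) - s₂ ^ 2 * (1 - c₁) ≠ 0 := by
      intro h
      apply hu
      field_simp
      linear_combination h
    obtain ⟨A, hA'⟩ : ∃ A, A = s₁ ^ 2 * (1 - c₂) - s₂ ^ 2 * (1 - c₁) := ⟨_, rfl⟩
    rw [← hA'] at hA
    -- `ℓ` is the chord slope `(v₁ - v₂)/(u₁ - u₂)` after clearing `1 - c₁` and `1 - c₂`.
    refine mkPoint_add_of_ne E₁ E₂ hu
      (ℓ := 2 * (s₁ * (1 - c₂) - s₂ * (1 - c₁)) / A) ?_ ?_ ?_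
    · field_simp
      rw [hA']
      ring
    · field_simp
      subst hD hS hN hA'
      clear hu₃ hv₃ E₁ E₂ hM hd e₃ hA hneg hc₃ hu hc₁ hc₂
      grind
    · field_simp
      subst hD hS hN hA'
      clear hu₃ hv₃ E₁ E₂ hM hd e₃ hA hneg hc₃ hu hc₁ hc₂
      grind
  · have := quarticPoint_injective (s₁ := s₁) (s₂ := -s₂) h₁ (by rw [h₂]; ring) (by
      rw [quarticPoint_neg h₂, quarticPoint_of_ne _ hc₁, quarticPoint_of_ne _ hc₂, neg_mkPoint E₂,
        hu, hv])
    exact absurd this hneg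
  · obtain ⟨rfl, rfl⟩ := quarticPoint_injective h₁ h₂ (by
      rw [quarticPoint_of_ne _ hc₁, quarticPoint_of_ne _ hc₂, hu, hv])
    have hs : s₁ ≠ 0 := by
      rintro rfl
      simp at hv0
    -- The tangent slope `(3u² + 4)/(2v)` simplifies to `(2 + c)/s` by `s⁴ = (1 - c)(1 + c)`.
    refine mkPoint_double E₁ hv0 (ℓ := (2 + c₁) / s₁) ?_ ?_ ?_
    · field_simp
      grind
    · field_simp
      subst hD hS hN
      clear hu₃ hv₃ E₁ E₂ hM hd e₃ hneg hc₃ hu hc₁ hc₂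
      grind
    · field_simp
      subst hD hS hN
      clear hu₃ hv₃ E₁ E₂ hM hd e₃ hneg hc₃ hu hc₁ hc₂
      grind

lemma mulI_quarticPoint {s c : ℂ} (h : c ^ 2 = 1 - s ^ 4) :
    mulI (quarticPoint s c) = quarticPoint (Complex.I * s) c := by
  by_cases hc : c = 1
  · subst hc
    simp [quarticPoint_one]
  · rw [quarticPoint_of_ne _ hc, quarticPoint_of_ne _ hc, mulI_mkPoint (quarticPoint_equation h hc)]
    congr 1
    · rw [mul_pow, Complex.I_sq]; ring
    · ring

/-! ### Real analysis of `φ`: inversion of the arc length, derivatives, zeros, addition law. -/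

section

open Set MeasureTheory

lemma arcLength_neg (r : ℝ) : arcLength (-r) = -arcLength r := by
  unfold arcLength
  have h := intervalIntegral.integral_comp_neg (a := 0) (b := r)
    (fun t : ℝ => 1 / √(1 - t ^ 4))
  have h' : ∀ t : ℝ, (-t) ^ 4 = t ^ 4 := fun t => by ring
  simp only [h', neg_zero] at h
  rw [h, intervalIntegral.integral_symm]

lemma intervalIntegrable_arcLength_symm :
    IntervalIntegrable (fun t : ℝ => 1 / √(1 - t ^ 4)) volume (-1) 1 := by
  refine IntervalIntegrable.trans (b := 0) ?_ intervalIntegrable_arcLength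
  have h := (intervalIntegrable_arcLength.comp_sub_left 0)
  have h' : ∀ t : ℝ, (-t) ^ 4 = t ^ 4 := fun t => by ring
  simp only [zero_sub, h', sub_zero] at h
  exact h.symm

lemma continuousOn_arcLength : ContinuousOn arcLength (Icc (-1) 1) := by
  have h := intervalIntegral.continuousOn_primitive_interval' intervalIntegrable_arcLength_symm
    (a := 0) (by rw [uIcc_of_le (by norm_num)]; norm_num)
  rwa [uIcc_of_le (by norm_num)] at h

lemma one_sub_pow_four_pos {r : ℝ} (h : r ∈ Ioo (-1 : ℝ) 1) : 0 < 1 - r ^ 4 := by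
  have : r ^ 2 < 1 := by nlinarith [h.1, h.2]
  nlinarith [sq_nonneg r]

lemma hasDerivAt_arcLength {r : ℝ} (h : r ∈ Ioo (-1 : ℝ) 1) :
    HasDerivAt arcLength (1 / √(1 - r ^ 4)) r := by
  have hm : Measurable (fun t : ℝ => 1 / √(1 - t ^ 4)) := by fun_prop
  refine intervalIntegral.integral_hasDerivAt_right
    (intervalIntegrable_arcLength_symm.mono_set ?_) hm.stronglyMeasurable.stronglyMeasurableAtFilter ?_
  · rw [uIcc_of_le (by norm_num : (-1 : ℝ) ≤ 1)]
    exact uIcc_subset_Icc (by norm_num) ⟨h.1.le, h.2.le⟩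
  · have := (Real.sqrt_pos.2 (one_sub_pow_four_pos h)).ne'
    exact ContinuousAt.div continuousAt_const (by fun_prop) this

lemma strictMonoOn_arcLength : StrictMonoOn arcLength (Icc (-1) 1) := by
  refine strictMonoOn_of_deriv_pos (convex_Icc _ _) continuousOn_arcLength fun r hr => ?_
  rw [interior_Icc] at hr
  rw [(hasDerivAt_arcLength hr).deriv]
  have := Real.sqrt_pos.2 (one_sub_pow_four_pos hr)
  positivity

lemma arcLength_one : arcLength 1 = varpi / 2 := by unfold varpi; ring

lemma arcLength_zero : arcLength 0 = 0 := intervalIntegral.integral_same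

lemma surjOn_arcLength : SurjOn arcLength (Icc (-1) 1) (Icc (-(varpi / 2)) (varpi / 2)) := by
  have h := intermediate_value_Icc (by norm_num : (-1 : ℝ) ≤ 1) continuousOn_arcLength
  rwa [arcLength_neg, arcLength_one] at h

/-- The inverse of `arcLength : [-1, 1] → [-ϖ/2, ϖ/2]`. -/
def arcInv : ℝ → ℝ := Function.invFunOn arcLength (Icc (-1) 1)

lemma arcInv_mem {s : ℝ} (h : s ∈ Icc (-(varpi / 2)) (varpi / 2)) : arcInv s ∈ Icc (-1 : ℝ) 1 :=
  Function.invFunOn_mem (surjOn_arcLength h)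

lemma arcLength_arcInv {s : ℝ} (h : s ∈ Icc (-(varpi / 2)) (varpi / 2)) :
    arcLength (arcInv s) = s := Function.invFunOn_eq (surjOn_arcLength h)

lemma arcInv_arcLength {r : ℝ} (h : r ∈ Icc (-1 : ℝ) 1) : arcInv (arcLength r) = r :=
  strictMonoOn_arcLength.injOn.leftInvOn_invFunOn h

lemma arcLength_mem {r : ℝ} (h : r ∈ Icc (-1 : ℝ) 1) :
    arcLength r ∈ Icc (-(varpi / 2)) (varpi / 2) := by
  have h1 := strictMonoOn_arcLength.monotoneOn (left_mem_Icc.2 (by norm_num)) h h.1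
  have h2 := strictMonoOn_arcLength.monotoneOn h (right_mem_Icc.2 (by norm_num)) h.2
  rw [arcLength_neg, arcLength_one] at h1
  rw [arcLength_one] at h2
  exact ⟨h1, h2⟩

lemma strictMonoOn_arcInv : StrictMonoOn arcInv (Icc (-(varpi / 2)) (varpi / 2)) := by
  intro a ha b hb hab
  by_contra! hc
  have := strictMonoOn_arcLength.monotoneOn (arcInv_mem hb) (arcInv_mem ha) hc
  rw [arcLength_arcInv ha, arcLength_arcInv hb] at this
  linarith

lemma arcInv_mem_Ioo {s : ℝ} (h : s ∈ Ioo (-(varpi / 2)) (varpi / 2)) :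
    arcInv s ∈ Ioo (-1 : ℝ) 1 := by
  have hv := varpi_pos
  have h1 : arcInv (varpi / 2) = 1 := by
    rw [← arcLength_one, arcInv_arcLength (by norm_num)]
  have h2 : arcInv (-(varpi / 2)) = -1 := by
    rw [← arcLength_one, ← arcLength_neg, arcInv_arcLength (by norm_num)]
  have h3 := strictMonoOn_arcInv (left_mem_Icc.2 (by linarith)) ⟨h.1.le, h.2.le⟩ h.1
  have h4 := strictMonoOn_arcInv ⟨h.1.le, h.2.le⟩ (right_mem_Icc.2 (by linarith)) h.2
  exact ⟨h2 ▸ h3, h1 ▸ h4⟩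

lemma continuousOn_arcInv : ContinuousOn arcInv (Icc (-(varpi / 2)) (varpi / 2)) := by
  let e : Icc (-1 : ℝ) 1 ≃ Icc (-(varpi / 2)) (varpi / 2) :=
    { toFun := fun r => ⟨arcLength r, arcLength_mem r.2⟩
      invFun := fun s => ⟨arcInv s, arcInv_mem s.2⟩
      left_inv := fun r => Subtype.ext (arcInv_arcLength r.2)
      right_inv := fun s => Subtype.ext (arcLength_arcInv s.2) }
  have he : Continuous e := by
    refine Continuous.subtype_mk ?_ _
    exact continuousOn_iff_continuous_domRestrict.1 continuousOn_arcLength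
  have := he.continuous_symm_of_equiv_compact_to_t2
  rw [continuousOn_iff_continuous_domRestrict]
  exact continuous_subtype_val.comp this

lemma hasDerivAt_arcInv {s : ℝ} (h : s ∈ Ioo (-(varpi / 2)) (varpi / 2)) :
    HasDerivAt arcInv (√(1 - arcInv s ^ 4)) s := by
  have hr := arcInv_mem_Ioo h
  have hp := Real.sqrt_pos.2 (one_sub_pow_four_pos hr)
  have := HasDerivAt.of_local_left_inverse
    (continuousOn_arcInv.continuousAt (Icc_mem_nhds h.1 h.2)) (hasDerivAt_arcLength hr)
    (by positivity) (by
      filter_upwards [Icc_mem_nhds h.1 h.2] with t ht using arcLength_arcInv ht)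
  simpa using this

/-- The sign `(-1)^n` on the period interval `[(n - 1/2)ϖ, (n + 1/2)ϖ)`. -/
def sgn (s : ℝ) : ℝ := (-1) ^ round (s / varpi)

lemma round_eq_zero {s : ℝ} (h : s ∈ Ico (-(varpi / 2)) (varpi / 2)) : round (s / varpi) = 0 := by
  have hv := varpi_pos
  rw [round_eq_zero_iff, mem_Ico, le_div_iff₀ hv, div_lt_iff₀ hv]
  constructor <;> linarith [h.1, h.2]

lemma sgn_eq_one {s : ℝ} (h : s ∈ Ico (-(varpi / 2)) (varpi / 2)) : sgn s = 1 := by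
  rw [sgn, round_eq_zero h, zpow_zero]

lemma sgn_add_varpi (s : ℝ) : sgn (s + varpi) = -sgn s := by
  have h : (s + varpi) / varpi = s / varpi + 1 := by
    rw [add_div, div_self varpi_pos.ne']
  rw [sgn, h, round_add_one, zpow_add_one₀ (by norm_num), sgn]
  ring

lemma sgn_sq (s : ℝ) : sgn s ^ 2 = 1 := by
  rw [sgn, ← zpow_natCast, zpow_comm]
  simp

lemma phiReal_eq_arcInv {s : ℝ} (h : s ∈ Icc (-(varpi / 2)) (varpi / 2)) :
    phiReal s = arcInv s := by
  have hv := varpi_pos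
  rcases h.2.eq_or_lt with rfl | h2
  -- `round` sends `1/2` to `1`, so the right endpoint already belongs to the next period interval
  -- and is reached by antiperiodicity.
  · have h1 : phiReal (varpi / 2) = -phiReal (-(varpi / 2)) := by
      rw [← phiReal_add_varpi]; congr 1; ring
    rw [h1, phiReal, round_eq_zero ⟨le_rfl, by linarith⟩]
    simp only [Int.cast_zero, zero_mul, sub_zero, zpow_zero, one_mul]
    change -arcInv _ = _
    rw [← arcLength_one, ← arcLength_neg, arcInv_arcLength (by norm_num),
      arcInv_arcLength (by norm_num)]
    norm_num
  · rw [phiReal, round_eq_zero ⟨h.1, h2⟩]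
    simp [arcInv]

/-- The derivative of `phiReal`, in closed form. -/
def psi (s : ℝ) : ℝ := sgn s * √(1 - phiReal s ^ 4)

lemma psi_add_varpi (s : ℝ) : psi (s + varpi) = -psi s := by
  rw [psi, psi, sgn_add_varpi, phiReal_add_varpi]
  rw [show (-phiReal s) ^ 4 = phiReal s ^ 4 by ring]
  ring

lemma exists_add_zsmul (x : ℝ) : ∃ y ∈ Ico (-(varpi / 2)) (varpi / 2), ∃ n : ℤ, x = y + n * varpi := by
  obtain ⟨n, hn⟩ := (existsUnique_sub_zsmul_mem_Ico varpi_pos x (-(varpi / 2))).exists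
  refine ⟨_, ⟨hn.1, ?_⟩, n, ?_⟩
  · have := hn.2; linarith
  · simp

lemma antiperiodic_induction {P : ℝ → Prop} (h : ∀ x ∈ Ico (-(varpi / 2)) (varpi / 2), P x)
    (hs : ∀ x, P x → P (x + varpi)) (hs' : ∀ x, P x → P (x - varpi)) (x : ℝ) : P x := by
  obtain ⟨y, hy, n, rfl⟩ := exists_add_zsmul x
  induction n using Int.induction_on with
  | zero => simpa using h y hy
  | succ n ih =>
    convert hs _ ih using 1
    push_cast; ring
  | pred n ih =>
    convert hs' _ ih using 1
    push_cast; ring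

lemma phiReal_mem (x : ℝ) : phiReal x ∈ Icc (-1 : ℝ) 1 := by
  refine antiperiodic_induction (P := fun x => phiReal x ∈ Icc (-1 : ℝ) 1) (fun x hx => ?_)
    (fun x hx => ?_) (fun x hx => ?_) x
  · have := Ico_subset_Icc_self hx
    rw [phiReal_eq_arcInv this]
    exact arcInv_mem this
  · rw [phiReal_add_varpi]; exact ⟨by linarith [hx.2], by linarith [hx.1]⟩
  · rw [phiReal_sub_varpi]; exact ⟨by linarith [hx.2], by linarith [hx.1]⟩

lemma psi_sq (x : ℝ) : psi x ^ 2 = 1 - phiReal x ^ 4 := by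
  have h := phiReal_mem x
  have h2 : phiReal x ^ 2 ≤ 1 := by nlinarith [h.1, h.2]
  rw [psi, mul_pow, sgn_sq, one_mul, Real.sq_sqrt]
  nlinarith [sq_nonneg (phiReal x)]

lemma continuous_of_antiperiodic {f : ℝ → ℝ} (hf : ∀ x, f (x + varpi) = -f x)
    (hc : ContinuousOn f (Icc (-(varpi / 2)) (varpi / 2))) : Continuous f := by
  have hv := varpi_pos
  have hf' : ∀ x, f (x - varpi) = -f x := fun x => by
    have := hf (x - varpi); rw [sub_add_cancel] at this; rw [this, neg_neg]
  -- Adjoining the previous interval makes `-ϖ/2` an interior point, so every point of the half-open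
  -- interval is covered.
  have h2 : ContinuousOn f (Icc (-(varpi / 2) - varpi) (varpi / 2 - varpi)) := by
    have : ContinuousOn (fun x => -f (x + varpi)) (Icc (-(varpi / 2) - varpi) (varpi / 2 - varpi)) := by
      refine (hc.comp (by fun_prop) fun x hx => ?_).neg
      exact ⟨by linarith [hx.1], by linarith [hx.2]⟩
    refine this.congr fun x _ => ?_
    simp only [hf, neg_neg]
  have h3 := h2.union_of_isClosed hc isClosed_Icc isClosed_Icc
  rw [continuous_iff_continuousAt]
  refine antiperiodic_induction (P := ContinuousAt f) (fun x hx => ?_)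
    (fun x hx => ?_) (fun x hx => ?_)
  · refine h3.continuousAt ?_
    refine Filter.mem_of_superset (Ioo_mem_nhds (show -(varpi / 2) - varpi < x by linarith [hx.1]) hx.2)
      fun y hy => ?_
    rcases le_total y (-(varpi / 2)) with h | h
    · exact .inl ⟨hy.1.le, by linarith⟩
    · exact .inr ⟨h, hy.2.le⟩
  · have : f = fun y => -f (y - varpi) := by
      funext y; rw [hf', neg_neg]
    rw [this]
    refine (ContinuousAt.comp (g := f) (f := fun y => y - varpi) ?_ (by fun_prop)).neg
    simpa using hx
  · have : f = fun y => -f (y + varpi) := by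
      funext y; rw [hf, neg_neg]
    rw [this]
    refine (ContinuousAt.comp (g := f) (f := fun y => y + varpi) ?_ (by fun_prop)).neg
    simpa using hx

lemma continuous_phiReal : Continuous phiReal :=
  continuous_of_antiperiodic phiReal_add_varpi
    (continuousOn_arcInv.congr fun _ hx => phiReal_eq_arcInv hx)

lemma psi_eq_sqrt {x : ℝ} (hx : x ∈ Icc (-(varpi / 2)) (varpi / 2)) :
    psi x = √(1 - phiReal x ^ 4) := by
  rcases hx.2.eq_or_lt with rfl | h
  -- At the right endpoint `sgn` has already jumped to `-1`, but the square root vanishes there.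
  · have : phiReal (varpi / 2) = 1 := by
      rw [phiReal_eq_arcInv hx, ← arcLength_one, arcInv_arcLength (by norm_num)]
    simp [psi, this]
  · rw [psi, sgn_eq_one ⟨hx.1, h⟩, one_mul]

lemma continuous_psi : Continuous psi := by
  refine continuous_of_antiperiodic psi_add_varpi ?_
  have h : Continuous fun x => √(1 - phiReal x ^ 4) := by
    have := continuous_phiReal
    fun_prop
  exact h.continuousOn.congr fun _ hx => psi_eq_sqrt hx

/-- The exceptional points `ϖ/2 + nϖ`. -/
def turningPoints : Set ℝ := range fun n : ℤ => -(varpi / 2) + n * varpi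

/-- At the turning points the arc length has infinite slope, so the inverse function rule is not
available. These points are countable, and `f` and `g` are continuous, so `f` is still a primitive
of `g`; the fundamental theorem then gives the derivative everywhere. -/
lemma hasDerivAt_of_antiperiodic {f g : ℝ → ℝ} (hf : ∀ x, f (x + varpi) = -f x)
    (hg : ∀ x, g (x + varpi) = -g x)
    (hfc : Continuous f) (hgc : Continuous g)
    (h : ∀ x ∈ Ioo (-(varpi / 2)) (varpi / 2), HasDerivAt f (g x) x) (x : ℝ) :
    HasDerivAt f (g x) x := by
  have hf' : ∀ x, f (x - varpi) = -f x := fun x => by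
    have := hf (x - varpi); rw [sub_add_cancel] at this; rw [this, neg_neg]
  have hg' : ∀ x, g (x - varpi) = -g x := fun x => by
    have := hg (x - varpi); rw [sub_add_cancel] at this; rw [this, neg_neg]
  have h1 : ∀ x, x ∈ turningPoints ∨ HasDerivAt f (g x) x := by
    refine antiperiodic_induction (fun x hx => ?_) (fun x hx => ?_) (fun x hx => ?_)
    · rcases hx.1.eq_or_lt with rfl | h1
      · exact .inl ⟨0, by simp⟩
      · exact .inr (h x ⟨h1, hx.2⟩)
    · rcases hx with ⟨n, rfl⟩ | hx
      · exact .inl ⟨n + 1, by push_cast; ring⟩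
      · right
        have : f = fun y => -f (y - varpi) := by
          funext y; rw [hf', neg_neg]
        rw [this, hg]
        refine (HasDerivAt.comp_sub_const (x + varpi) varpi ?_).neg
        simpa using hx
    · rcases hx with ⟨n, rfl⟩ | hx
      · exact .inl ⟨n - 1, by push_cast; ring⟩
      · right
        have : f = fun y => -f (y + varpi) := by
          funext y; rw [hf, neg_neg]
        rw [this, hg']
        refine (HasDerivAt.comp_add_const (x - varpi) varpi ?_).neg
        simpa using hx
  have hS : turningPoints.Countable := countable_range _
  have h2 : ∀ y, f y = f 0 + ∫ t in (0 : ℝ)..y, g t := fun y => by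
    rw [MeasureTheory.integral_eq_of_hasDerivAt_off_countable f g hS hfc.continuousOn
      (fun t ht => (h1 t).resolve_left ht.2) (hgc.intervalIntegrable _ _)]
    ring
  rw [funext h2]
  exact (hgc.integral_hasStrictDerivAt 0 x).hasDerivAt.const_add _

lemma hasDerivAt_phiReal (x : ℝ) : HasDerivAt phiReal (psi x) x := by
  refine hasDerivAt_of_antiperiodic phiReal_add_varpi psi_add_varpi continuous_phiReal
    continuous_psi (fun x hx => ?_) x
  have hx' := Ioo_subset_Icc_self hx
  rw [psi_eq_sqrt hx', phiReal_eq_arcInv hx']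
  refine (hasDerivAt_arcInv hx).congr_of_eventuallyEq ?_
  filter_upwards [Icc_mem_nhds hx.1 hx.2] with t ht using phiReal_eq_arcInv ht

lemma hasDerivAt_psi (x : ℝ) : HasDerivAt psi (-2 * phiReal x ^ 3) x := by
  refine hasDerivAt_of_antiperiodic (g := fun x => -2 * phiReal x ^ 3) psi_add_varpi
    (fun x => ?_) continuous_psi ?_ (fun x hx => ?_) x
  · simp only [phiReal_add_varpi]; ring
  · have := continuous_phiReal
    fun_prop
  have hx' := Ioo_subset_Icc_self hx
  have hm := arcInv_mem_Ioo hx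
  rw [← phiReal_eq_arcInv hx'] at hm
  have hp := one_sub_pow_four_pos hm
  have h := (((hasDerivAt_phiReal x).pow 4).const_sub 1).sqrt hp.ne'
  have h2 : HasDerivAt psi _ x := h.congr_of_eventuallyEq (by
    filter_upwards [Icc_mem_nhds hx.1 hx.2] with t ht using psi_eq_sqrt ht)
  convert h2 using 1
  rw [psi_eq_sqrt hx']
  have := (Real.sqrt_pos.2 hp).ne'
  simp only [Pi.pow_apply]
  field_simp
  norm_num

lemma deriv_phiReal : deriv phiReal = psi := funext fun x => (hasDerivAt_phiReal x).deriv

lemma phiReal_zero : phiReal 0 = 0 := by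
  have hv := varpi_pos
  rw [phiReal_eq_arcInv ⟨by linarith, by linarith⟩]
  nth_rw 1 [← arcLength_zero]
  exact arcInv_arcLength (by norm_num)

lemma psi_zero : psi 0 = 1 := by
  have hv := varpi_pos
  rw [psi_eq_sqrt ⟨by linarith, by linarith⟩, phiReal_zero]
  norm_num

lemma exists_of_phiReal_eq_zero {x : ℝ} (h : phiReal x = 0) : ∃ n : ℤ, x = n * varpi := by
  obtain ⟨y, hy, n, rfl⟩ := exists_add_zsmul x
  refine ⟨n, ?_⟩
  have hy' := Ico_subset_Icc_self hy
  have h0 : phiReal y = 0 := by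
    have : ∀ n : ℤ, phiReal (y + n * varpi) = 0 → phiReal y = 0 := by
      intro n
      induction n using Int.induction_on with
      | zero => simp
      | succ n ih =>
        intro h
        apply ih
        rw [← neg_eq_zero, ← phiReal_add_varpi, ← h]
        congr 1; push_cast; ring
      | pred n ih =>
        intro h
        apply ih
        rw [← neg_eq_zero, ← phiReal_sub_varpi, ← h]
        congr 1; push_cast; ring
    exact this n h
  rw [phiReal_eq_arcInv hy'] at h0
  have := arcLength_arcInv hy'
  rw [h0, arcLength_zero] at this
  rw [← this, zero_add]

lemma phiReal_intCast_mul_varpi (n : ℤ) : phiReal (n * varpi) = 0 := by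
  induction n using Int.induction_on with
  | zero => simp [phiReal_zero]
  | succ n ih =>
    push_cast at ih ⊢
    rw [add_mul, one_mul, phiReal_add_varpi, ih, neg_zero]
  | pred n ih =>
    push_cast at ih ⊢
    rw [sub_mul, one_mul, phiReal_sub_varpi, ih, neg_zero]

lemma psi_intCast_mul_varpi (n : ℤ) : psi (n * varpi) = (-1) ^ n := by
  induction n using Int.induction_on with
  | zero => simp [psi_zero]
  | succ n ih =>
    push_cast at ih ⊢
    rw [add_mul, one_mul, psi_add_varpi, ih, zpow_add_one₀ (by norm_num)]
    ring
  | pred n ih =>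
    push_cast at ih ⊢
    have := psi_add_varpi ((-n - 1) * varpi)
    rw [show (-(n : ℝ) - 1) * varpi + varpi = -n * varpi by ring, ih] at this
    rw [zpow_sub_one₀ (by norm_num), this]
    norm_num

lemma exists_phiReal_eq {r : ℝ} (h : r ∈ Icc (-1 : ℝ) 1) : ∃ x, phiReal x = r :=
  ⟨arcLength r, by rw [phiReal_eq_arcInv (arcLength_mem h), arcInv_arcLength h]⟩

/-- The addition law for `φ` on `ℝ`. -/
lemma phiReal_add (x y : ℝ) :
    phiReal (x + y) = (phiReal x * psi y + phiReal y * psi x) / (1 + phiReal x ^ 2 * phiReal y ^ 2) := by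
  -- Euler's argument: with the sum `a` held fixed, the right-hand side is a function of `x` with
  -- zero derivative, so it equals its value at `x = 0`.
  obtain ⟨a, rfl⟩ : ∃ a, y = a - x := ⟨x + y, by ring⟩
  have hd : ∀ t, HasDerivAt (fun t => (phiReal t * psi (a - t) + phiReal (a - t) * psi t)
      / (1 + phiReal t ^ 2 * phiReal (a - t) ^ 2)) 0 t := by
    intro t
    have h1 := hasDerivAt_phiReal t
    have h2 := hasDerivAt_psi t
    have h3 : HasDerivAt (fun t => phiReal (a - t)) (-psi (a - t)) t :=
      (hasDerivAt_phiReal (a - t)).comp_const_sub a t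
    have h4 : HasDerivAt (fun t => psi (a - t)) (-(-2 * phiReal (a - t) ^ 3)) t :=
      (hasDerivAt_psi (a - t)).comp_const_sub a t
    have hpos : 1 + phiReal t ^ 2 * phiReal (a - t) ^ 2 ≠ 0 := by positivity
    have := ((h1.mul h4).add (h3.mul h2)).div (((h1.pow 2).mul (h3.pow 2)).const_add 1) hpos
    refine HasDerivAt.congr_deriv this ?_
    rw [div_eq_zero_iff]
    left
    have e1 := psi_sq t
    have e2 := psi_sq (a - t)
    simp only [Pi.pow_apply, Pi.mul_apply, Pi.add_apply]
    grind
  have hc := is_const_of_deriv_eq_zero (fun t => (hd t).differentiableAt) (fun t => (hd t).deriv) x 0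
  rw [add_sub_cancel]
  rw [hc, sub_zero, phiReal_zero, psi_zero]
  simp

/-- Obtained by differentiating `phiReal_add` in `x`, with `psi² = 1 - phiReal⁴`. -/
lemma psi_add (x y : ℝ) :
    psi (x + y) = (psi x * psi y * (1 - phiReal x ^ 2 * phiReal y ^ 2)
      - 2 * phiReal x * phiReal y * (phiReal x ^ 2 + phiReal y ^ 2))
        / (1 + phiReal x ^ 2 * phiReal y ^ 2) ^ 2 := by
  have hpos : 1 + phiReal x ^ 2 * phiReal y ^ 2 ≠ 0 := by positivity
  have h : HasDerivAt (fun t => phiReal (t + y)) (psi (x + y)) x :=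
    (hasDerivAt_phiReal (x + y)).comp_add_const x y
  have h1 := hasDerivAt_phiReal x
  have h2 := hasDerivAt_psi x
  have h' := ((h1.mul_const (psi y)).add (h2.const_mul (phiReal y))).div
    (((h1.pow 2).mul_const (phiReal y ^ 2)).const_add 1) hpos
  have := h.unique (h'.congr_of_eventuallyEq (.of_forall fun t => phiReal_add t y))
  rw [this]
  congr 1
  have e1 := psi_sq x
  simp only [Pi.pow_apply, Pi.add_apply]
  grind

end

/-! ### The uniformisation of the curve by ℂ, its surjectivity and its kernel. -/

lemma psi_sq_complex (x : ℝ) : (psi x : ℂ) ^ 2 = 1 - (phiReal x : ℂ) ^ 4 := by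
  exact_mod_cast psi_sq x

/-- The parametrisation of the real points by arc length. -/
def realPoint : ℝ →+ CPoint where
  toFun x := quarticPoint (phiReal x) (psi x)
  map_zero' := by rw [psi_zero, Complex.ofReal_one, quarticPoint_one]
  map_add' x y := by
    have hd : (1 + (phiReal x : ℂ) ^ 2 * (phiReal y : ℂ) ^ 2) ≠ 0 := by
      have : (1 + phiReal x ^ 2 * phiReal y ^ 2) ≠ 0 := by positivity
      exact_mod_cast this
    rw [quarticPoint_add (psi_sq_complex x) (psi_sq_complex y) hd, phiReal_add, psi_add]
    simp [addS, addC]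

lemma realPoint_apply (x : ℝ) : realPoint x = quarticPoint (phiReal x) (psi x) := rfl

/-- The uniformisation `ℂ → E(ℂ)`, `x + i y ↦ P(x) + [i] P(y)`. -/
def param : ℂ →+ CPoint where
  toFun z := realPoint z.re + mulI (realPoint z.im)
  map_zero' := by simp
  map_add' z w := by
    simp only [Complex.add_re, Complex.add_im, map_add]
    abel

lemma param_apply (z : ℂ) : param z = realPoint z.re + mulI (realPoint z.im) := rfl

lemma param_I_mul (z : ℂ) : param (Complex.I * z) = mulI (param z) := by
  simp [param_apply, mulI_mulI, add_comm]

/-- The action of a Gaussian integer on points. -/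
def act (γ : GaussianInt) : CPoint →+ CPoint :=
  γ.re • AddMonoidHom.id CPoint + γ.im • mulI

lemma act_apply (γ : GaussianInt) (P : CPoint) : act γ P = γ.re • P + γ.im • mulI P := rfl

lemma act_param (γ : GaussianInt) (z : ℂ) :
    act γ (param z) = param (GaussianInt.toComplex γ * z) := by
  rw [act_apply, ← param_I_mul, ← map_zsmul, ← map_zsmul, ← map_add, GaussianInt.toComplex_def]
  congr 1
  simp only [zsmul_eq_mul]
  ring

lemma mapPoint_act (σ : ℂ →+* ℂ) (hσ : σ Complex.I = Complex.I) (γ : GaussianInt) (P : CPoint) :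
    mapPoint σ (act γ P) = act γ (mapPoint σ P) := by
  simp only [act_apply, map_add, map_zsmul, mapPoint_mulI σ hσ]

lemma mulI_realPoint (y : ℝ) :
    mulI (realPoint y) = quarticPoint (Complex.I * phiReal y) (psi y) :=
  mulI_quarticPoint (psi_sq_complex y)

lemma I_mul_pow_four (s : ℂ) : (Complex.I * s) ^ 4 = s ^ 4 := by
  rw [mul_pow, Complex.I_pow_four, one_mul]

lemma two_torsion_cases {P : CPoint} (h : P + P = 0) :
    P = 0 ∨ P = mkPoint 0 0 ∨ P = mkPoint (2 * Complex.I) 0 ∨ P = mkPoint (-2 * Complex.I) 0 := by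
  rcases point_cases P with rfl | ⟨u, v, huv, rfl⟩
  · exact .inl rfl
  · right
    rw [add_eq_zero_iff_eq_neg, neg_mkPoint huv, mkPoint_inj huv (by rw [neg_sq, huv])] at h
    obtain rfl : v = 0 := by linear_combination h.2 / 2
    have h0 : u * ((u - 2 * Complex.I) * (u + 2 * Complex.I)) = 0 := by
      linear_combination -huv - 4 * u * Complex.I_sq
    rcases mul_eq_zero.1 h0 with rfl | h0
    · exact .inl rfl
    · right
      rcases mul_eq_zero.1 h0 with h0 | h0
      · left; congr 1; linear_combination h0
      · right; congr 1; linear_combination h0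

/-- At `(0, 0)` the function `2u/v` truly vanishes; at `(±2i, 0)` it has poles, and division by zero
supplies the same default value as in `phi`. -/
lemma sval_eq_zero_of_add_self {P : CPoint} (h : P + P = 0) : sval P = 0 := by
  have h1 : (0 : ℂ) ^ 2 = (2 * Complex.I) ^ 3 + 4 * (2 * Complex.I) := by
    linear_combination -8 * Complex.I * Complex.I_sq
  have h2 : (0 : ℂ) ^ 2 = (-2 * Complex.I) ^ 3 + 4 * (-2 * Complex.I) := by
    linear_combination 8 * Complex.I * Complex.I_sq
  rcases two_torsion_cases h with rfl | rfl | rfl | rfl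
  · rfl
  · rw [sval_mkPoint (by norm_num)]; simp
  · rw [sval_mkPoint h1]; simp
  · rw [sval_mkPoint h2]; simp

/-- `φ` is the coordinate `2u / v` of the uniformisation. -/
lemma phi_eq_sval (z : ℂ) : phi z = sval (param z) := by
  have hs := psi_sq_complex z.re
  have ht := psi_sq_complex z.im
  have ht' : (psi z.im : ℂ) ^ 2 = 1 - (Complex.I * phiReal z.im) ^ 4 := by rw [I_mul_pow_four, ht]
  have hI : (Complex.I * (phiReal z.im : ℂ)) ^ 2 = -(phiReal z.im : ℂ) ^ 2 := by
    rw [mul_pow, Complex.I_sq]; ring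
  by_cases hd : 1 - (phiReal z.re : ℂ) ^ 2 * (phiReal z.im : ℂ) ^ 2 = 0
  · have hd' : 1 - phiReal z.re ^ 2 * phiReal z.im ^ 2 = 0 := by exact_mod_cast hd
    have b1 := phiReal_mem z.re
    have b2 := phiReal_mem z.im
    have c1 : phiReal z.re ^ 2 ≤ 1 := by nlinarith [b1.1, b1.2]
    have c2 : phiReal z.im ^ 2 ≤ 1 := by nlinarith [b2.1, b2.2]
    have e1 : phiReal z.re ^ 2 = 1 := by nlinarith [sq_nonneg (phiReal z.re)]
    have e2 : phiReal z.im ^ 2 = 1 := by nlinarith [sq_nonneg (phiReal z.im)]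
    -- A vanishing denominator forces `φ(x)² = φ(y)² = 1`. Both real points then double to `(0,
    -- -1)`, so `param z` is 2-torsion and both sides take the value `0`.
    have hdbl : ∀ x, phiReal x ^ 2 = 1 → realPoint x + realPoint x = quarticPoint 0 (-1) := by
      intro x hx
      have hx' : (phiReal x : ℂ) ^ 2 = 1 := by exact_mod_cast hx
      have hψ : psi x = 0 := by
        have := psi_sq x
        rw [show phiReal x ^ 4 = (phiReal x ^ 2) ^ 2 by ring, hx] at this
        simpa using this
      rw [realPoint_apply, quarticPoint_add (psi_sq_complex x) (psi_sq_complex x)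
        (by rw [hx']; norm_num)]
      congr 1
      · simp [addS, hψ]
      · rw [addC, hψ, hx']
        have : 2 * (phiReal x : ℂ) * phiReal x = 2 := by linear_combination 2 * hx'
        rw [this]
        norm_num
    have h0 : param z + param z = 0 := by
      have : param z + param z = (realPoint z.re + realPoint z.re)
          + mulI (realPoint z.im + realPoint z.im) := by
        rw [param_apply, map_add]; abel
      rw [this, hdbl _ e1, hdbl _ e2, mulI_quarticPoint (by norm_num), mul_zero,
        quarticPoint_add (by norm_num) (by norm_num) (by norm_num)]
      simp [addC, quarticPoint_one]
    rw [sval_eq_zero_of_add_self h0, phi, hd, div_zero]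
  · have hd' : 1 + (phiReal z.re : ℂ) ^ 2 * (Complex.I * (phiReal z.im : ℂ)) ^ 2 ≠ 0 := by
      rw [hI]; intro h; exact hd (by linear_combination h)
    rw [param_apply, mulI_realPoint, realPoint_apply, quarticPoint_add hs ht' hd',
      sval_quarticPoint (addC_sq hs ht' hd'), phi, addS, hI, deriv_phiReal]
    congr 1
    ring

lemma realPoint_varpi : realPoint varpi = quarticPoint 0 (-1) := by
  have h1 := phiReal_intCast_mul_varpi 1
  have h2 := psi_intCast_mul_varpi 1
  simp only [Int.cast_one, one_mul, zpow_one] at h1 h2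
  rw [realPoint_apply, h1, h2]
  simp

/-- Over a given `s = phiReal x` the two possible values `±psi x` of `c` are attained at `x` and `ϖ
- x`. -/
lemma exists_realPoint_quarticPoint {s c : ℝ} (h : c ^ 2 = 1 - s ^ 4) :
    ∃ x, realPoint x = quarticPoint s c := by
  have hs : s ∈ Set.Icc (-1 : ℝ) 1 := by
    have h1 : s ^ 4 ≤ 1 := by nlinarith [sq_nonneg c]
    have h2 : s ^ 2 ≤ 1 := by nlinarith [sq_nonneg (s ^ 2)]
    constructor <;> nlinarith
  obtain ⟨x, rfl⟩ := exists_phiReal_eq hs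
  have h0 : (c - psi x) * (c + psi x) = 0 := by linear_combination h - psi_sq x
  rcases mul_eq_zero.1 h0 with h0 | h0
  · exact ⟨x, by rw [realPoint_apply, sub_eq_zero.1 h0]⟩
  · refine ⟨varpi - x, ?_⟩
    have hc : (psi x : ℂ) = -c := by
      have : psi x = -c := by linarith
      rw [this]; simp
    have e := psi_sq_complex x
    rw [map_sub, realPoint_varpi, sub_eq_add_neg, realPoint_apply, ← quarticPoint_neg e,
      quarticPoint_add (by norm_num) (by rw [e]; ring) (by norm_num)]
    simp [addS, addC, hc]

lemma quarticPoint_zero_neg_one : quarticPoint 0 (-1) = mkPoint 0 0 := by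
  rw [quarticPoint_of_ne _ (by norm_num)]
  simp

/-- Every point fixed by complex conjugation is parametrised by arc length. -/
lemma exists_realPoint_eq {P : CPoint} (h : mapPoint (starRingEnd ℂ) P = P) :
    ∃ x, realPoint x = P := by
  rcases point_cases P with rfl | ⟨u, v, huv, rfl⟩
  · exact ⟨0, map_zero _⟩
  · rw [mapPoint_mkPoint _ huv, mkPoint_inj (map_equation _ huv) huv] at h
    obtain ⟨a, rfl⟩ := Complex.conj_eq_iff_real.1 h.1
    obtain ⟨b, rfl⟩ := Complex.conj_eq_iff_real.1 h.2
    have hab : b ^ 2 = a ^ 3 + 4 * a := by exact_mod_cast huv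
    by_cases ha : a = 0
    · subst ha
      have : b = 0 := by simpa using hab
      subst this
      refine ⟨varpi, ?_⟩
      rw [realPoint_varpi, quarticPoint_zero_neg_one]
      simp
    have hb : b ≠ 0 := by
      rintro rfl
      have : a * (a ^ 2 + 4) = 0 := by linear_combination -hab
      have h4 : a ^ 2 + 4 ≠ 0 := by positivity
      exact (mul_ne_zero ha h4) this
    -- These are the coordinates `s = 2u/v` and `c = 1 - 8u/v²` inverting `quarticPoint`.
    have hsc : (1 - 8 * a / b ^ 2) ^ 2 = 1 - (2 * a / b) ^ 4 := by
      field_simp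
      linear_combination -16 * a * hab
    obtain ⟨x, hx⟩ := exists_realPoint_quarticPoint hsc
    refine ⟨x, ?_⟩
    have hb' : (b : ℂ) ≠ 0 := by exact_mod_cast hb
    have ha' : (a : ℂ) ≠ 0 := by exact_mod_cast ha
    rw [hx, quarticPoint_of_ne]
    · push_cast
      rw [sub_sub_cancel]
      congr 1
      · field_simp
        norm_num
      · field_simp
        norm_num
    · push_cast
      rw [Ne, sub_eq_self]
      simp [ha', hb']

/-- With `realPoint x = (2, 4)`, the points `(±2i, 0)` come from `x ∓ ix`, and `(0, 0)` comes from
`ϖ`. -/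
lemma two_torsion_mem_range {P : CPoint} (h : P + P = 0) : ∃ z, param z = P := by
  obtain ⟨x, hx⟩ := exists_realPoint_quarticPoint (s := 1) (c := 0) (by norm_num)
  have h4 : quarticPoint ((1 : ℝ) : ℂ) ((0 : ℝ) : ℂ) = mkPoint 2 4 := by
    rw [quarticPoint_of_ne _ (by simp)]; simp
  rw [h4] at hx
  have hJ : mulI (mkPoint 2 4) = mkPoint (-2) (4 * Complex.I) := by
    rw [mulI_mkPoint (by norm_num), mul_comm]
  rcases two_torsion_cases h with rfl | rfl | rfl | rfl
  · exact ⟨0, map_zero _⟩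
  · refine ⟨varpi, ?_⟩
    simp [param_apply, realPoint_varpi, quarticPoint_zero_neg_one]
  · refine ⟨⟨x, -x⟩, ?_⟩
    rw [param_apply, map_neg, map_neg, hx, hJ,
      neg_mkPoint (by linear_combination 16 * Complex.I_sq)]
    refine mkPoint_add_of_ne (ℓ := 1 + Complex.I) (by norm_num)
      (by linear_combination 16 * Complex.I_sq) (by norm_num) (by ring) ?_ ?_
    · linear_combination -Complex.I_sq
    · linear_combination 2 * Complex.I_sq
  · refine ⟨⟨x, x⟩, ?_⟩
    rw [param_apply, hx, hJ]
    refine mkPoint_add_of_ne (ℓ := 1 - Complex.I) (by norm_num)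
      (by linear_combination 16 * Complex.I_sq) (by norm_num) (by ring) ?_ ?_
    · linear_combination -Complex.I_sq
    · linear_combination 2 * Complex.I_sq

/-- Write `2Q = (Q + Q̄) + (Q - Q̄)`. Both `Q + Q̄` and `[i](Q - Q̄)` are fixed by conjugation,
hence parametrised by arc length. Halving the parameters reaches `Q` up to a 2-torsion point, which
is also in the image. -/
lemma param_surjective : Function.Surjective param := by
  intro Q
  obtain ⟨a, ha⟩ := exists_realPoint_eq (P := Q + mapPoint (starRingEnd ℂ) Q) (by
    rw [map_add, mapPoint_conj_conj, add_comm])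
  obtain ⟨b, hb⟩ := exists_realPoint_eq (P := mulI (Q - mapPoint (starRingEnd ℂ) Q)) (by
    rw [mapPoint_conj_mulI, map_sub, mapPoint_conj_conj, ← map_neg, neg_sub])
  have hb' : mulI (realPoint b) = mapPoint (starRingEnd ℂ) Q - Q := by
    rw [hb, mulI_mulI, neg_sub]
  have e1 : realPoint (a / 2) + realPoint (a / 2) = realPoint a := by rw [← map_add, add_halves]
  have e2 : realPoint (b / 2) + realPoint (b / 2) = realPoint b := by rw [← map_add, add_halves]
  obtain ⟨w, hw⟩ := two_torsion_mem_range (P := Q - param ⟨a / 2, -(b / 2)⟩) (by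
    have : param ⟨a / 2, -(b / 2)⟩ + param ⟨a / 2, -(b / 2)⟩ = Q + Q := by
      rw [param_apply]
      simp only [map_neg]
      have : realPoint (a / 2) + -mulI (realPoint (b / 2))
          + (realPoint (a / 2) + -mulI (realPoint (b / 2)))
          = (realPoint (a / 2) + realPoint (a / 2))
            - mulI (realPoint (b / 2) + realPoint (b / 2)) := by
        rw [map_add]; abel
      rw [this, e1, e2, hb', ha]
      abel
    rw [sub_add_sub_comm, this, sub_self])
  exact ⟨w + ⟨a / 2, -(b / 2)⟩, by rw [map_add, hw, sub_add_cancel]⟩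

/-- The kernel of the uniformisation is the period lattice `(1 + i)ϖ ℤ[i]`. -/
lemma param_eq_zero_iff (z : ℂ) :
    param z = 0 ↔ ∃ γ : GaussianInt, z = GaussianInt.toComplex γ * ((1 + Complex.I) * varpi) := by
  constructor
  · intro h
    have hs := psi_sq_complex z.re
    have ht := psi_sq_complex z.im
    have ht' : (psi z.im : ℂ) ^ 2 = 1 - (Complex.I * phiReal z.im) ^ 4 := by rw [I_mul_pow_four, ht]
    rw [param_apply, add_eq_zero_iff_eq_neg, mulI_realPoint, ← quarticPoint_neg ht',
      realPoint_apply] at h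
    obtain ⟨h1, h2⟩ := quarticPoint_injective hs (by rw [ht']; ring) h
    have hre : phiReal z.re = 0 := by simpa using congrArg Complex.re h1
    have him : phiReal z.im = 0 := by simpa using congrArg Complex.im h1
    obtain ⟨m, hm⟩ := exists_of_phiReal_eq_zero hre
    obtain ⟨n, hn⟩ := exists_of_phiReal_eq_zero him
    have h3 : ((-1 : ℝ)) ^ m = (-1) ^ n := by
      rw [← psi_intCast_mul_varpi, ← psi_intCast_mul_varpi, ← hm, ← hn]
      exact_mod_cast h2
    have h4 : Even (n - m) := by
      by_contra hc
      rw [Int.not_even_iff_odd] at hc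
      have h5 : (-1 : ℝ) ^ (n - m) = 1 := by
        rw [zpow_sub₀ (by norm_num), h3, div_self]
        exact zpow_ne_zero _ (by norm_num)
      rw [hc.neg_one_zpow] at h5
      norm_num at h5
    obtain ⟨k, hk⟩ := h4
    -- With `n = m + 2k`, `(m + k + ki)(1 + i) = m + ni`.
    refine ⟨⟨m + k, k⟩, ?_⟩
    obtain rfl : n = m + k + k := by omega
    apply Complex.ext
    · simp [GaussianInt.toComplex_def, hm]
      ring
    · simp [GaussianInt.toComplex_def, hn]
      ring
  · rintro ⟨γ, rfl⟩
    have h0 : param ((1 + Complex.I) * varpi) = 0 := by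
      rw [param_apply]
      simp only [Complex.mul_re, Complex.add_re, Complex.one_re, Complex.I_re, Complex.ofReal_re,
        Complex.add_im, Complex.one_im, Complex.I_im, Complex.ofReal_im, Complex.mul_im]
      simp only [add_zero, one_mul, mul_zero, sub_zero, zero_add, realPoint_varpi]
      rw [mulI_quarticPoint (by norm_num), mul_zero,
        quarticPoint_add (by norm_num) (by norm_num) (by norm_num)]
      simp [addC, quarticPoint_one]
    rw [← act_param, h0, map_zero]

lemma act_one (P : CPoint) : act 1 P = P := by simp [act_apply]

lemma act_add (a b : GaussianInt) (P : CPoint) : act (a + b) P = act a P + act b P := by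
  simp only [act_apply, Zsqrtd.re_add, Zsqrtd.im_add, add_zsmul]
  abel

/-- Through the surjection `param` this is associativity of multiplication in ℂ. -/
lemma act_mul (a b : GaussianInt) (P : CPoint) : act (a * b) P = act a (act b P) := by
  obtain ⟨z, rfl⟩ := param_surjective P
  simp only [act_param, map_mul, mul_assoc]

/-! ### Integrality of the division values of odd order. -/

lemma mkPoint_eq_quarticPoint {u v : ℂ} (h : v ^ 2 = u ^ 3 + 4 * u) (hv : v ≠ 0) :
    ∃ c : ℂ, c ^ 2 = 1 - (2 * u / v) ^ 4 ∧ mkPoint u v = quarticPoint (2 * u / v) c := by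
  have hu : u ≠ 0 := by
    rintro rfl
    exact hv (by simpa using h)
  refine ⟨1 - 8 * u / v ^ 2, ?_, ?_⟩
  · field_simp
    linear_combination -16 * u * h
  · rw [quarticPoint_of_ne _ (by rw [Ne, sub_eq_self]; simp [hu, hv]), sub_sub_cancel]
    congr 1
    · field_simp
      norm_num
    · field_simp
      norm_num

/-- The pole `(2i, 0)`. -/
def pole : CPoint := mkPoint (2 * Complex.I) 0

lemma pole_equation : (0 : ℂ) ^ 2 = (2 * Complex.I) ^ 3 + 4 * (2 * Complex.I) := by
  linear_combination -8 * Complex.I * Complex.I_sq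

/-- Translation by a pole acts on the coordinate `s = 2u/v` as `s ↦ i/s`, exchanging values outside
a valuation ring with values in its maximal ideal. -/
lemma add_pole {u v : ℂ} (h : v ^ 2 = u ^ 3 + 4 * u) (hv : v ≠ 0) :
    ∃ c : ℂ, c ^ 2 = 1 - (Complex.I / (2 * u / v)) ^ 4 ∧
      mkPoint u v + pole = quarticPoint (Complex.I / (2 * u / v)) c := by
  have hf : u * ((u - 2 * Complex.I) * (u + 2 * Complex.I)) = v ^ 2 := by
    linear_combination -h - 4 * u * Complex.I_sq
  have hv2 : v ^ 2 ≠ 0 := pow_ne_zero 2 hv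
  have hu : u ≠ 0 := by rintro rfl; exact hv2 (by rw [← hf]; ring)
  have h1 : u - 2 * Complex.I ≠ 0 := by intro h; exact hv2 (by rw [← hf, h]; ring)
  have h2 : u + 2 * Complex.I ≠ 0 := by intro h; exact hv2 (by rw [← hf, h]; ring)
  have hI := Complex.I_ne_zero
  have key : mkPoint u v + pole = mkPoint (2 * Complex.I * (u + 2 * Complex.I) / (u - 2 * Complex.I))
      (8 * v / (u - 2 * Complex.I) ^ 2) := by
    refine mkPoint_add_of_ne (ℓ := v / (u - 2 * Complex.I)) h pole_equation (sub_ne_zero.1 h1)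
      ?_ ?_ ?_
    · field_simp
      ring
    · field_simp
      linear_combination hf
    · field_simp
      linear_combination 8 * Complex.I_sq
  have hv₃ : 8 * v / (u - 2 * Complex.I) ^ 2 ≠ 0 :=
    div_ne_zero (mul_ne_zero (by norm_num) hv) (pow_ne_zero 2 h1)
  have h₃ : (8 * v / (u - 2 * Complex.I) ^ 2) ^ 2
      = (2 * Complex.I * (u + 2 * Complex.I) / (u - 2 * Complex.I)) ^ 3
        + 4 * (2 * Complex.I * (u + 2 * Complex.I) / (u - 2 * Complex.I)) := by
    field_simp
    have := Complex.I_sq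
    grind
  obtain ⟨c, hc, hc'⟩ := mkPoint_eq_quarticPoint h₃ hv₃
  have hs : 2 * (2 * Complex.I * (u + 2 * Complex.I) / (u - 2 * Complex.I))
      / (8 * v / (u - 2 * Complex.I) ^ 2) = Complex.I / (2 * u / v) := by
    field_simp
    linear_combination 8 * hf
  rw [hs] at hc hc'
  exact ⟨c, hc, by rw [key, hc']⟩

lemma quarticPoint_add_zero_neg_one {s c : ℂ} (h : c ^ 2 = 1 - s ^ 4) :
    quarticPoint s c + quarticPoint 0 (-1) = quarticPoint (-s) (-c) := by
  rw [quarticPoint_add h (by norm_num) (by norm_num)]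
  simp [addS, addC]

/-- The kernel of reduction on the quartic model at a valuation ring of `ℂ`. -/
def reductionKernel (V : ValuationSubring ℂ) : AddSubgroup CPoint where
  carrier := {P | ∃ s c : ℂ, c ^ 2 = 1 - s ^ 4 ∧ V.valuation s < 1 ∧ V.valuation (c - 1) < 1 ∧
    P = quarticPoint s c}
  zero_mem' := ⟨0, 1, by norm_num, by simp, by simp, (quarticPoint_one 0).symm⟩
  neg_mem' := by
    rintro _ ⟨s, c, h, hs, hc, rfl⟩
    exact ⟨-s, c, by rw [h]; ring, by rwa [Valuation.map_neg], hc, (quarticPoint_neg h).symm⟩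
  add_mem' := by
    rintro _ _ ⟨s₁, c₁, h₁, hs₁, hc₁, rfl⟩ ⟨s₂, c₂, h₂, hs₂, hc₂, rfl⟩
    have mem : ∀ {x}, V.valuation x < 1 → x ∈ V := fun h => (V.valuation_le_one_iff _).1 h.le
    have lt : ∀ {x y}, V.valuation x < 1 → y ∈ V → V.valuation (x * y) < 1 := fun {x y} hx hy => by
      rw [map_mul]
      exact mul_lt_one_of_lt_of_le hx ((V.valuation_le_one_iff _).2 hy)
    have m₁ := mem hs₁
    have m₂ := mem hs₂
    have one : (1 : ℂ) ∈ V := V.one_mem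
    have n₁ : c₁ ∈ V := by simpa using add_mem (mem hc₁) one
    have n₂ : c₂ ∈ V := by simpa using add_mem (mem hc₂) one
    -- The denominator of the addition formulas is a unit of `V`.
    have hD : V.valuation (1 + s₁ ^ 2 * s₂ ^ 2) = 1 := by
      refine Valuation.map_one_add_of_lt _ ?_
      have := lt hs₁ (mul_mem m₁ (pow_mem m₂ 2))
      rwa [show s₁ ^ 2 * s₂ ^ 2 = s₁ * (s₁ * s₂ ^ 2) by ring]
    have hd : 1 + s₁ ^ 2 * s₂ ^ 2 ≠ 0 := by
      intro h
      rw [h, map_zero] at hD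
      exact zero_ne_one hD
    refine ⟨_, _, addC_sq h₁ h₂ hd, ?_, ?_, quarticPoint_add h₁ h₂ hd⟩
    · rw [addS, map_div₀, hD, div_one]
      exact Valuation.map_add_lt _ (lt hs₁ n₂) (lt hs₂ n₁)
    · rw [addC, div_sub_one (pow_ne_zero _ hd), map_div₀, map_pow, hD, one_pow, div_one]
      -- Each summand has a factor `c₁ - 1`, `c₂ - 1` or `s₁` in the maximal ideal.
      have e : c₁ * c₂ * (1 - s₁ ^ 2 * s₂ ^ 2) - 2 * s₁ * s₂ * (s₁ ^ 2 + s₂ ^ 2)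
          - (1 + s₁ ^ 2 * s₂ ^ 2) ^ 2 = (c₁ - 1) * c₂ + (c₂ - 1) * 1
            + s₁ * (-(c₁ * c₂ * s₁ * s₂ ^ 2) - (s₂ + s₂) * (s₁ ^ 2 + s₂ ^ 2)
              - (s₁ * s₂ ^ 2 + s₁ * s₂ ^ 2) - s₁ ^ 3 * s₂ ^ 4) := by ring
      rw [e]
      refine Valuation.map_add_lt _ (Valuation.map_add_lt _ (lt hc₁ n₂) (lt hc₂ one)) (lt hs₁ ?_)
      have k₁ : ∀ n, s₁ ^ n ∈ V := fun n => pow_mem m₁ n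
      have k₂ : ∀ n, s₂ ^ n ∈ V := fun n => pow_mem m₂ n
      exact sub_mem (sub_mem (sub_mem (neg_mem (mul_mem (mul_mem (mul_mem n₁ n₂) m₁) (k₂ 2)))
        (mul_mem (add_mem m₂ m₂) (add_mem (k₁ 2) (k₂ 2))))
        (add_mem (mul_mem m₁ (k₂ 2)) (mul_mem m₁ (k₂ 2)))) (mul_mem (k₁ 3) (k₂ 4))

lemma I_mem_valuationSubring (V : ValuationSubring ℂ) : Complex.I ∈ V := by
  rcases V.mem_or_inv_mem Complex.I with h | h
  · exact h
  · simpa using neg_mem h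

lemma act_mem_reductionKernel {V : ValuationSubring ℂ} (γ : GaussianInt) {P : CPoint}
    (h : P ∈ reductionKernel V) : act γ P ∈ reductionKernel V := by
  refine add_mem (zsmul_mem h _) (zsmul_mem ?_ _)
  obtain ⟨s, c, h, hs, hc, rfl⟩ := h
  refine ⟨Complex.I * s, c, by rw [I_mul_pow_four, h], ?_, hc, mulI_quarticPoint h⟩
  rw [map_mul, mul_comm]
  exact mul_lt_one_of_lt_of_le hs ((V.valuation_le_one_iff _).2 (I_mem_valuationSubring V))

lemma IsOdd.isCoprime_two {β : GaussianInt} (hβ : IsOdd β) : IsCoprime β 2 := by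
  have h2 : (2 : GaussianInt) = ⟨1, 1⟩ * ⟨1, -1⟩ := by decide
  have h3 : (⟨1, -1⟩ : GaussianInt) = ⟨1, 1⟩ * ⟨0, -1⟩ := by decide
  have h4 : IsUnit (⟨0, -1⟩ : GaussianInt) := IsUnit.of_mul_eq_one ⟨0, 1⟩ (by decide)
  rw [h2, h3]
  exact IsCoprime.mul_right hβ ((isCoprime_mul_unit_right_right h4 _ _).2 hβ)

/-- With `aβ + 2b = 1`, `T = aβT = aβ(P + T)`, and the kernel of reduction is stable under ℤ[i]. -/
lemma two_torsion_mem_of_odd {V : ValuationSubring ℂ} {β : GaussianInt} (hβ : IsOdd β)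
    {P T : CPoint} (hP : act β P = 0) (hT : T + T = 0) (h : P + T ∈ reductionKernel V) :
    T ∈ reductionKernel V := by
  obtain ⟨a, b, hab⟩ := hβ.isCoprime_two
  have h1 : T = act a (act β (P + T)) := by
    have h2 : act 2 T = 0 := by rw [← one_add_one_eq_two, act_add, act_one, hT]
    conv_lhs => rw [← act_one T, ← hab, act_add, act_mul, act_mul, h2, map_zero, add_zero]
    rw [map_add (act β), hP, zero_add]
  rw [h1]
  exact act_mem_reductionKernel _ (act_mem_reductionKernel _ h)

/-- The division values of odd order are algebraic integers. -/
lemma isIntegral_sval {β : GaussianInt} (hβ : IsOdd β) {P : CPoint} (hP : act β P = 0) :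
    IsIntegral ℤ (sval P) := by
  by_contra hint
  have : IsIntegrallyClosedIn (integralClosure ℤ ℂ).toSubring ℂ :=
    inferInstanceAs (IsIntegrallyClosedIn (integralClosure ℤ ℂ) ℂ)
  -- An integrally closed subring is an intersection of valuation rings, so some `V` omits the
  -- value.
  obtain ⟨V, -, hV⟩ := (integralClosure ℤ ℂ).toSubring.exists_le_valuationSubring_of_isIntegrallyClosedIn
    (x := sval P) hint
  have hV1 : 1 < V.valuation (sval P) := by
    rw [← not_le, V.valuation_le_one_iff]; exact hV
  have hs0 : sval P ≠ 0 := by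
    intro h; rw [h] at hV; exact hV V.zero_mem
  rcases point_cases P with rfl | ⟨u, v, huv, rfl⟩
  · exact hs0 rfl
  rw [sval_mkPoint huv] at *
  have hv : v ≠ 0 := by rintro rfl; simp at hs0
  obtain ⟨c, hc, hadd⟩ := add_pole huv hv
  have hs : V.valuation (Complex.I / (2 * u / v)) < 1 := by
    rw [map_div₀]
    refine (div_lt_one₀ (zero_lt_one.trans hV1)).2 (lt_of_le_of_lt ?_ hV1)
    exact (V.valuation_le_one_iff _).2 (I_mem_valuationSubring V)
  generalize Complex.I / (2 * u / v) = s at *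
  have hpole : pole + pole = 0 := by
    rw [pole, add_eq_zero_iff_eq_neg, neg_mkPoint pole_equation, neg_zero]
  have hz : quarticPoint 0 (-1) + quarticPoint 0 (-1) = 0 := by
    rw [quarticPoint_add_zero_neg_one (by norm_num), neg_neg, quarticPoint_one]
  -- The point `(0, -1)` cannot be excluded: in residue characteristic 2 it does reduce to the
  -- origin.
  have hker : ∀ T : CPoint, T + T = 0 → T ∈ reductionKernel V → T = 0 ∨ T = quarticPoint 0 (-1) := by
    rintro T hT ⟨s, c, h, -, -, rfl⟩
    have h0 := sval_eq_zero_of_add_self hT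
    rw [sval_quarticPoint h] at h0
    subst h0
    have : (c - 1) * (c + 1) = 0 := by linear_combination h
    rcases mul_eq_zero.1 this with h | h
    · left; rw [sub_eq_zero.1 h, quarticPoint_one]
    · right; rw [eq_neg_of_add_eq_zero_left h]
  have hp0 : pole ≠ 0 := mkPoint_ne_zero pole_equation
  have hp1 : pole ≠ quarticPoint 0 (-1) := by
    rw [quarticPoint_zero_neg_one, pole, Ne, mkPoint_inj pole_equation (by norm_num)]
    simp
  -- From `(c - 1)(c + 1) = -s⁴`, `c` reduces to `1` or `-1`. In the second case a further
  -- translation by `(0, -1)` changes the sign of `c`, so `T` is `pole` or `pole + (0, -1)`.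
  have hprod : V.valuation (c - 1) < 1 ∨ V.valuation (c + 1) < 1 := by
    by_contra! hcon
    have h1 : V.valuation ((c - 1) * (c + 1)) = V.valuation s ^ 4 := by
      rw [show (c - 1) * (c + 1) = -s ^ 4 by linear_combination hc, Valuation.map_neg, map_pow]
    rw [map_mul] at h1
    have h2 : V.valuation s ^ 4 < 1 := pow_lt_one₀ zero_le hs (by norm_num)
    rw [← h1] at h2
    exact absurd h2 (not_lt.2 (one_le_mul hcon.1 hcon.2))
  rcases hprod with h | h
  · have hmem := two_torsion_mem_of_odd (V := V) hβ hP hpole ⟨s, c, hc, hs, h, hadd⟩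
    rcases hker _ hpole hmem with h | h
    · exact hp0 h
    · exact hp1 h
  · have hT : (pole + quarticPoint 0 (-1)) + (pole + quarticPoint 0 (-1)) = 0 := by
      rw [add_add_add_comm, hpole, hz, add_zero]
    have hmem := two_torsion_mem_of_odd (V := V) hβ hP hT
      ⟨-s, -c, by rw [neg_sq, hc]; ring, by rwa [Valuation.map_neg],
        by rw [← Valuation.map_neg]; convert h using 2; ring,
        by rw [← add_assoc, hadd, quarticPoint_add_zero_neg_one hc]⟩
    rcases hker _ hT hmem with h | h
    · apply hp1
      rw [add_eq_zero_iff_eq_neg.1 h, neg_eq_of_add_eq_zero_left hz]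
    · exact hp0 (by simpa using h)

/-! ### Numbers fixed by the automorphisms of ℂ. -/

/-- An algebraic element of a purely transcendental extension lies in the base field. -/
lemma mem_range_of_isAlgebraic_of_mem_adjoin {K E ι : Type*} [Field K] [Field E] [Algebra K E]
    {t : ι → E} (ht : AlgebraicIndependent K t) {x : E} (hx : IsAlgebraic K x)
    (hxt : x ∈ IntermediateField.adjoin K (Set.range t)) : ∃ y : K, algebraMap K E y = x := by
  obtain ⟨r, s, h⟩ := (IntermediateField.mem_adjoin_range_iff K t x).1 hxt
  by_cases hs : MvPolynomial.aeval t s = 0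
  · exact ⟨0, by rw [h, hs, div_zero, map_zero]⟩
  have ht' := ht.algebraicClosure
  let x' : algebraicClosure K E := ⟨x, (mem_algebraicClosure_iff).2 hx⟩
  let L := algebraicClosure K E
  have hm : ∀ p : MvPolynomial ι K,
      MvPolynomial.aeval t (MvPolynomial.map (algebraMap K L) p) = MvPolynomial.aeval t p := fun p => by
    rw [MvPolynomial.aeval_map_algebraMap]
  -- `t` stays independent over the algebraic closure of `K` in `E`, so `r(t) = x s(t)` is an
  -- identity of polynomials; comparing one nonzero coefficient of `s` exhibits `x` in `K`.
  have h0 : MvPolynomial.map (algebraMap K L) r = MvPolynomial.C x' * MvPolynomial.map (algebraMap K L) s := by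
    apply ht'
    rw [map_mul]
    simp only [hm, MvPolynomial.algHom_C]
    change _ = x * _
    rw [h, div_mul_cancel₀ _ hs]
  have hs0 : s ≠ 0 := by rintro rfl; simp at hs
  obtain ⟨m, hm⟩ := MvPolynomial.ne_zero_iff.1 hs0
  have h1 := congrArg (MvPolynomial.coeff m) h0
  rw [MvPolynomial.coeff_C_mul, MvPolynomial.coeff_map, MvPolynomial.coeff_map] at h1
  have h2 : algebraMap K E (r.coeff m) = x * algebraMap K E (s.coeff m) := congrArg Subtype.val h1
  refine ⟨r.coeff m / s.coeff m, ?_⟩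
  rw [map_div₀, h2, mul_div_cancel_right₀]
  simpa using hm

/-- An algebraic number fixed by all automorphisms of `ℂ` over `K` lies in `K`. -/
lemma mem_range_of_fixed {K : Type} [Field K] [Algebra K ℂ] {x : ℂ} (hx : IsAlgebraic K x)
    (h : ∀ σ : ℂ ≃ₐ[K] ℂ, σ x = x) : ∃ y : K, algebraMap K ℂ y = x := by
  obtain ⟨s, hs⟩ := exists_isTranscendenceBasis K ℂ
  have halg := hs.isAlgebraic_field
  let F := IntermediateField.adjoin K (Set.range (Subtype.val : s → ℂ))
  have : CharZero F := (algebraMap F ℂ).charZero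
  have : IsAlgClosure F ℂ := ⟨inferInstance, halg⟩
  have : IsGalois F ℂ := ⟨⟩
  -- ℂ is an algebraic closure of `F = K(s)` in characteristic zero, hence Galois over it, and
  -- automorphisms over `F` are automorphisms over `K`.
  have hbot := (InfiniteGalois.mem_bot_iff_fixed (k := F) x).2 fun σ => h (σ.restrictScalars K)
  obtain ⟨y, rfl⟩ := IntermediateField.mem_bot.1 hbot
  exact mem_range_of_isAlgebraic_of_mem_adjoin hs.1 hx y.2

/-- An algebraic integer fixed by all automorphisms of `ℂ` that fix `i` is a Gaussian integer. -/
lemma exists_gaussianInt_of_fixed {x : ℂ} (hx : IsIntegral ℤ x)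
    (h : ∀ σ : ℂ ≃+* ℂ, σ Complex.I = Complex.I → σ x = x) :
    ∃ γ : GaussianInt, GaussianInt.toComplex γ = x := by
  let K := FractionRing GaussianInt
  let _ : Algebra K ℂ := (IsFractionRing.lift GaussianInt.toComplex_injective).toAlgebra
  have hlift : ∀ γ : GaussianInt,
      algebraMap K ℂ (algebraMap GaussianInt K γ) = GaussianInt.toComplex γ := fun γ =>
    IsFractionRing.lift_algebraMap _ _
  have hI : algebraMap K ℂ (algebraMap GaussianInt K ⟨0, 1⟩) = Complex.I := by
    rw [hlift, GaussianInt.toComplex_def]; simp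
  have hxK : IsIntegral K x := by
    obtain ⟨p, hp, hpx⟩ := hx
    refine ⟨p.map (Int.castRingHom K), hp.map _, ?_⟩
    rw [eval₂_map, ← hpx]
    congr 1
    exact RingHom.ext_int _ _
  obtain ⟨y, rfl⟩ := mem_range_of_fixed (K := K) hxK.isAlgebraic fun σ =>
    h σ.toRingEquiv (by
      rw [← hI]
      exact σ.commutes _)
  have hy : IsIntegral ℤ y := by
    obtain ⟨p, hp, hpy⟩ := hx
    refine ⟨p, hp, (algebraMap K ℂ).injective ?_⟩
    rw [hom_eval₂, map_zero, ← hpy]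
    congr 1
    exact RingHom.ext_int _ _
  obtain ⟨γ, rfl⟩ := IsIntegrallyClosed.algebraMap_eq_of_integral (R := GaussianInt) hy.tower_top
  exact ⟨γ, (hlift γ).symm⟩

/-! ### The `β`-torsion and the Galois action on it. -/

lemma finite_quotient {β : GaussianInt} (hβ : β ≠ 0) :
    Finite (GaussianInt ⧸ Ideal.span ({β} : Set GaussianInt)) := by
  have hn : β.norm ≠ 0 := fun h => hβ ((GaussianInt.norm_eq_zero).1 h)
  -- The norm of `β` lies in `(β)`, so residues of both coordinates modulo the norm represent every
  -- class.
  have hmem : ∀ γ : GaussianInt, (β.norm : GaussianInt) * γ ∈ Ideal.span ({β} : Set GaussianInt) := by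
    intro γ
    rw [Zsqrtd.norm_eq_mul_conj, mul_assoc]
    exact Ideal.mul_mem_right _ _ (Ideal.mem_span_singleton_self β)
  have hfin : Finite (Set.Icc 0 |β.norm| ×ˢ Set.Icc 0 |β.norm| : Set (ℤ × ℤ)) :=
    ((Set.finite_Icc _ _).prod (Set.finite_Icc _ _)).to_subtype
  refine Finite.of_surjective (fun p : (Set.Icc 0 |β.norm| ×ˢ Set.Icc 0 |β.norm| : Set (ℤ × ℤ)) =>
    Ideal.Quotient.mk (Ideal.span ({β} : Set GaussianInt)) ⟨p.1.1, p.1.2⟩) fun u => ?_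
  obtain ⟨a, rfl⟩ := Ideal.Quotient.mk_surjective u
  have hb : ∀ n : ℤ, n % β.norm ∈ Set.Icc 0 |β.norm| := fun n =>
    ⟨Int.emod_nonneg _ hn, (Int.emod_lt_abs _ hn).le⟩
  refine ⟨⟨(a.re % β.norm, a.im % β.norm), hb _, hb _⟩, ?_⟩
  rw [eq_comm, Ideal.Quotient.eq]
  convert hmem ⟨a.re / β.norm, a.im / β.norm⟩ using 1
  have h1 := Int.emod_add_mul_ediv a.re β.norm
  have h2 := Int.emod_add_mul_ediv a.im β.norm
  ext
  · simp; linarith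
  · simp; linarith

/-- The torsion point attached to `α mod β`. -/
def torsionPoint (β α : GaussianInt) : CPoint := param (GaussianInt.toComplex α * delta β)

lemma torsionPoint_eq_act (β α : GaussianInt) :
    torsionPoint β α = act α (torsionPoint β 1) := by
  rw [torsionPoint, torsionPoint, act_param, map_one, one_mul]

lemma mul_delta {β : GaussianInt} (hβ : β ≠ 0) :
    GaussianInt.toComplex β * delta β = (1 + Complex.I) * varpi :=
  mul_div_cancel₀ _ (by simpa [GaussianInt.toComplex_eq_zero] using hβ)

lemma torsionPoint_eq_zero_iff {β : GaussianInt} (hβ : β ≠ 0) (α : GaussianInt) :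
    torsionPoint β α = 0 ↔ α ∈ Ideal.span ({β} : Set GaussianInt) := by
  rw [torsionPoint, param_eq_zero_iff, Ideal.mem_span_singleton']
  have hδ : delta β ≠ 0 := by
    intro h
    have := mul_delta hβ
    rw [h, mul_zero] at this
    have h1 : (1 + Complex.I) ≠ 0 := fun h => by simpa using congrArg Complex.re h
    exact mul_ne_zero h1 (by exact_mod_cast varpi_pos.ne') this.symm
  refine exists_congr fun γ => ?_
  rw [← mul_delta hβ, ← mul_assoc, mul_left_inj' hδ, ← map_mul, GaussianInt.toComplex_inj, eq_comm]

lemma torsionPoint_sub (β a b : GaussianInt) :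
    torsionPoint β (a - b) = torsionPoint β a - torsionPoint β b := by
  simp only [torsionPoint, map_sub, sub_mul]

lemma torsionPoint_eq_iff {β : GaussianInt} (hβ : β ≠ 0) (a b : GaussianInt) :
    torsionPoint β a = torsionPoint β b ↔
      Ideal.Quotient.mk (Ideal.span ({β} : Set GaussianInt)) a = Ideal.Quotient.mk _ b := by
  rw [← sub_eq_zero, ← torsionPoint_sub, torsionPoint_eq_zero_iff hβ, Ideal.Quotient.eq]

lemma act_torsionPoint {β : GaussianInt} (hβ : β ≠ 0) (α : GaussianInt) :
    act β (torsionPoint β α) = 0 := by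
  rw [torsionPoint_eq_act, ← act_mul, ← torsionPoint_eq_act, torsionPoint_eq_zero_iff hβ]
  exact Ideal.mul_mem_right _ _ (Ideal.mem_span_singleton_self β)

lemma exists_torsionPoint_eq {β : GaussianInt} (hβ : β ≠ 0) {P : CPoint} (h : act β P = 0) :
    ∃ α, torsionPoint β α = P := by
  obtain ⟨z, rfl⟩ := param_surjective P
  rw [act_param, param_eq_zero_iff] at h
  obtain ⟨γ, hγ⟩ := h
  have hβ' : GaussianInt.toComplex β ≠ 0 := by
    simpa [GaussianInt.toComplex_eq_zero] using hβ
  refine ⟨γ, ?_⟩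
  rw [torsionPoint]
  congr 1
  apply mul_left_cancel₀ hβ'
  rw [hγ, ← mul_delta hβ]
  ring

/-- An automorphism fixing `i` acts on the `β`-torsion as multiplication by a unit modulo `β`. -/
lemma exists_unit_mapPoint {β : GaussianInt} (hβ : β ≠ 0) (σ : ℂ ≃+* ℂ)
    (hσ : σ Complex.I = Complex.I) :
    ∃ (w : (GaussianInt ⧸ Ideal.span ({β} : Set GaussianInt))ˣ) (a : GaussianInt),
      Ideal.Quotient.mk _ a = (w : GaussianInt ⧸ Ideal.span ({β} : Set GaussianInt)) ∧
      ∀ α, mapPoint σ (torsionPoint β α) = torsionPoint β (α * a) := by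
  -- The torsion is generated over ℤ[i] by `torsionPoint β 1`, so a ℤ[i]-linear map is determined by
  -- the multiplier `a` of that generator. The multipliers of `σ` and `σ⁻¹` are inverse modulo `β`.
  have hex : ∀ τ : ℂ ≃+* ℂ, τ Complex.I = Complex.I → ∃ a,
      ∀ α, mapPoint τ (torsionPoint β α) = torsionPoint β (α * a) := fun τ hτ => by
    obtain ⟨a, ha⟩ := exists_torsionPoint_eq hβ (P := mapPoint τ (torsionPoint β 1)) (by
      rw [← mapPoint_act _ hτ, act_torsionPoint hβ, map_zero])
    refine ⟨a, fun α => ?_⟩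
    rw [torsionPoint_eq_act, mapPoint_act _ hτ, ← ha, torsionPoint_eq_act β a, ← act_mul,
      ← torsionPoint_eq_act]
  have hσ' : σ.symm Complex.I = Complex.I := by rw [RingEquiv.symm_apply_eq, hσ]
  obtain ⟨a, ha⟩ := hex σ hσ
  obtain ⟨b, hb⟩ := hex σ.symm hσ'
  have hcomp : ∀ P, mapPoint (σ.symm : ℂ →+* ℂ) (mapPoint (σ : ℂ →+* ℂ) P) = P := by
    intro P
    rcases point_cases P with rfl | ⟨u, v, h, rfl⟩
    · simp
    · rw [mapPoint_mkPoint _ h, mapPoint_mkPoint _ (map_equation _ h)]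
      simp
  have h1 := hcomp (torsionPoint β 1)
  rw [ha, hb, one_mul, torsionPoint_eq_iff hβ, map_mul, map_one] at h1
  exact ⟨Units.mkOfMulEqOne _ _ h1, a, rfl, ha⟩

lemma divisionValue_mk (β α : GaussianInt) :
    divisionValue β (Ideal.Quotient.mk _ α) = sval (torsionPoint β α) :=
  phi_eq_sval _

lemma isIntegral_divisionValue {β : GaussianInt} (hβ : IsOdd β) (hβ0 : β ≠ 0)
    (u : GaussianInt ⧸ Ideal.span ({β} : Set GaussianInt)) : IsIntegral ℤ (divisionValue β u) := by
  obtain ⟨α, rfl⟩ := Ideal.Quotient.mk_surjective u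
  rw [divisionValue_mk]
  exact isIntegral_sval hβ (act_torsionPoint hβ0 α)

lemma exists_unit_divisionValue {β : GaussianInt} (hβ : β ≠ 0) (σ : ℂ ≃+* ℂ)
    (hσ : σ Complex.I = Complex.I) :
    ∃ w : (GaussianInt ⧸ Ideal.span ({β} : Set GaussianInt))ˣ,
      ∀ u, σ (divisionValue β u) = divisionValue β (u * w) := by
  obtain ⟨w, a, hw, ha⟩ := exists_unit_mapPoint hβ σ hσ
  refine ⟨w, fun u => ?_⟩
  obtain ⟨α, rfl⟩ := Ideal.Quotient.mk_surjective u
  rw [← hw, ← map_mul, divisionValue_mk, divisionValue_mk, ← ha, sval_mapPoint]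
  rfl

/-! ### The coefficients of `Λ_β`. -/

lemma IsOdd.ne_zero {β : GaussianInt} (hβ : IsOdd β) : β ≠ 0 := by
  rintro rfl
  have h := isCoprime_zero_left.1 hβ
  rw [← Zsqrtd.norm_eq_one_iff] at h
  revert h
  decide

lemma lemnatomic_eq_prod (β : GaussianInt)
    [Fintype (GaussianInt ⧸ Ideal.span ({β} : Set GaussianInt))ˣ] :
    lemnatomic β = ∏ u : (GaussianInt ⧸ Ideal.span ({β} : Set GaussianInt))ˣ,
      (X - C (divisionValue β u)) :=
  finprod_eq_prod_of_fintype _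

/-- `σ` moves the root indexed by `u` to the one indexed by `u * w`, and multiplication by the unit
`w` permutes the index set. -/
lemma map_lemnatomic {β : GaussianInt} (hβ : β ≠ 0) (σ : ℂ ≃+* ℂ)
    (hσ : σ Complex.I = Complex.I) : (lemnatomic β).map (σ : ℂ →+* ℂ) = lemnatomic β := by
  have := finite_quotient hβ
  have := Fintype.ofFinite (GaussianInt ⧸ Ideal.span ({β} : Set GaussianInt))ˣ
  obtain ⟨w, hw⟩ := exists_unit_divisionValue hβ σ hσ
  rw [lemnatomic_eq_prod, Polynomial.map_prod]
  refine Fintype.prod_equiv (Equiv.mulRight w) _ _ fun u => ?_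
  simp [hw]

lemma isIntegral_coeff_lemnatomic {β : GaussianInt} (hβ : IsOdd β) (n : ℕ) :
    IsIntegral ℤ ((lemnatomic β).coeff n) := by
  have := finite_quotient hβ.ne_zero
  have := Fintype.ofFinite (GaussianInt ⧸ Ideal.span ({β} : Set GaussianInt))ˣ
  have h : lemnatomic β = (∏ u : (GaussianInt ⧸ Ideal.span ({β} : Set GaussianInt))ˣ,
      (X - C (⟨divisionValue β u, isIntegral_divisionValue hβ hβ.ne_zero u⟩ :
        integralClosure ℤ ℂ))).map (algebraMap (integralClosure ℤ ℂ) ℂ) := by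
    rw [lemnatomic_eq_prod, Polynomial.map_prod]
    refine Finset.prod_congr rfl fun u _ => ?_
    rw [Polynomial.map_sub, map_X, map_C]
    rfl
  rw [h, coeff_map]
  exact Subtype.property _

end

end Lemniscate

theorem lemma5p2 (β : GaussianInt) (hβ : Lemniscate.IsOdd β) :
    Lemniscate.lemnatomic β ∈ Polynomial.lifts GaussianInt.toComplex ∧
      (Lemniscate.lemnatomic β).Monic ∧
      (Lemniscate.lemnatomic β).natDegree =
        Nat.card (GaussianInt ⧸ Ideal.span ({β} : Set GaussianInt))ˣ := by
  have := Lemniscate.finite_quotient hβ.ne_zero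
  have := Fintype.ofFinite (GaussianInt ⧸ Ideal.span ({β} : Set GaussianInt))ˣ
  refine ⟨(Polynomial.lifts_iff_coeff_lifts _).2 fun n => ?_, ?_, ?_⟩
  · refine Lemniscate.exists_gaussianInt_of_fixed (Lemniscate.isIntegral_coeff_lemnatomic hβ n)
      fun σ hσ => ?_
    have := congrArg (fun p => Polynomial.coeff p n) (Lemniscate.map_lemnatomic hβ.ne_zero σ hσ)
    simpa [Polynomial.coeff_map] using this
  · rw [Lemniscate.lemnatomic_eq_prod]
    exact Polynomial.monic_prod_X_sub_C _ _
  · rw [Lemniscate.lemnatomic_eq_prod, Polynomial.natDegree_finsetProd_X_sub_C_eq_card,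
      Finset.card_univ, Nat.card_eq_fintype_card]
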